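/- A convex polyhedron is a compact intersection of finitely many closed half-spaces of $\mathbb{R}^3$. It is called semiregular if it is three-dimensional, all its 2-faces are regular polygons, and its symmetry group acts transitively on its vertices (so the Platonic solids, the prisms and antiprisms with regular faces, and the Archimedean solids are semiregular). For such a polyhedron $Q$ let $V(Q)$ be its vertex set, $f_i(Q)$ its number of $i$-dimensional faces, and $R_1[Q]$ its rectification, the convex hull of the midpoints of the edges of $Q$. Put $R_0[P]=P$ and $R_{i+1}[P]=R_1[R_i[P]]$. For $v\in V(Q)$ let $Q/v$ be the vertex figure truncated to half the edge length, that is, the convex hull of the midpoints of the edges of $Q$ containing $v$. Theorem 4. Let $k\ge 1$ and let $P\to R_1[P]\to\cdots\to R_{k-1}[P]$ be a rectification sequence all of whose members $R_0[P],\dots,R_{k-1}[P]$ are semiregular. Then $$\bigl(f_0(R_k[P]),f_1(R_k[P]),f_2(R_k[P])\bigr)=\bigl(2^{k-1}f_1(P),\;2^{k}f_1(P),\;2+2^{k-1}f_1(P)\bigr)$$ and $$\operatorname{vol}(R_k[P])=\operatorname{vol}(P)-\sum_{v\in V(P)}\operatorname{vol}\bigl(\operatorname{conv}(P/v\cup\{v\})\bigr)-\sum_{N=1}^{k-1}\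 \sum_{v\in V(R_N[P])}\operatorname{vol}\bigl(\operatorname{conv}(R_N[P]/v\cup\{v\})\bigr).$$ -/

import Mathlib

open scoped EuclideanGeometry

noncomputable section

namespace Rectification

/-- Euclidean three-space. -/
abbrev E3 : Type := EuclideanSpace ℝ (Fin 3)

/-- A compact intersection of finitely many closed half-spaces of `ℝ³`
(possibly of dimension less than three). -/
def IsConvexPolyhedron (P : Set E3) : Prop :=
  IsCompact P ∧ ∃ H : Set (E3 × ℝ), H.Finite ∧ (∀ h ∈ H, h.1 ≠ 0) ∧
    P = {x | ∀ h ∈ H, inner ℝ h.1 x ≤ h.2}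

/-- The nonempty faces of `P` of dimension `i`: the nonempty sets of maximizers over `P` of a
linear functional, whose affine hull has dimension `i`. -/
def faces (P : Set E3) (i : ℕ) : Set (Set E3) :=
  {F | F.Nonempty ∧ IsExposed ℝ P F ∧ Module.finrank ℝ (vectorSpan ℝ F) = i}

/-- `f_i(P)`, the number of `i`-dimensional faces. -/
def fNumber (P : Set E3) (i : ℕ) : ℕ := (faces P i).ncard

/-- The vertex set `V(P)`. -/
def vertices (P : Set E3) : Set E3 := {v | {v} ∈ faces P 0}

/-- The graph `G_P` of `P`: `v` and `w` are adjacent when the segment `[v, w]` is an edge of `P`. -/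
def graph (P : Set E3) : SimpleGraph E3 where
  Adj v w := segment ℝ v w ∈ faces P 1
  symm := ⟨fun v w h => by
    rw [segment_symm]
    exact h⟩
  loopless := ⟨fun v h => by
    have h1 := h.2.2
    rw [segment_same, vectorSpan_singleton, finrank_bot] at h1
    exact zero_ne_one h1⟩

/-- The rectification `R₁[P]`: the convex hull of the midpoints of the edges of `P`. -/
def rectify (P : Set E3) : Set E3 :=
  convexHull ℝ {m | ∃ v w, (graph P).Adj v w ∧ m = midpoint ℝ v w}

/-- The `k`-th rectification `R_k[P]`, with `R₀[P] = P`. -/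
def R (k : ℕ) (P : Set E3) : Set E3 := rectify^[k] P

/-- A regular polygon in `ℝ³`: a two-dimensional convex polygon all of whose sides have the same
length and all of whose interior angles are equal. -/
structure IsRegularPolygon (F : Set E3) : Prop where
  polygon : IsConvexPolyhedron F
  dim_eq : Module.finrank ℝ (vectorSpan ℝ F) = 2
  equilateral : ∀ v w v' w', (graph F).Adj v w → (graph F).Adj v' w' → dist v w = dist v' w'
  equiangular : ∀ u v w u' v' w',
    (graph F).Adj v u → (graph F).Adj v w → u ≠ w →
    (graph F).Adj v' u' → (graph F).Adj v' w' → u' ≠ w' → ∠ u v w = ∠ u' v' w'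

/-- A semiregular polyhedron: a three-dimensional convex polyhedron whose facets are regular
polygons and whose symmetry group is transitive on the vertices. -/
structure IsSemiregular (P : Set E3) : Prop where
  polyhedron : IsConvexPolyhedron P
  dim_eq : Module.finrank ℝ (vectorSpan ℝ P) = 3
  regular_faces : ∀ F ∈ faces P 2, IsRegularPolygon F
  vertex_transitive : ∀ v ∈ vertices P, ∀ w ∈ vertices P,
    ∃ φ : E3 ≃ᵃⁱ[ℝ] E3, φ '' P = P ∧ φ v = w

/-- The vertex figure `P / v` truncated to half the edge length: the convex hull of the midpoints
of the edges of `P` that contain `v`. -/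
def vertexFigure (P : Set E3) (v : E3) : Set E3 :=
  convexHull ℝ {m | ∃ w, (graph P).Adj v w ∧ m = midpoint ℝ v w}

/-- The cone `conv((P / v) ∪ {v})` that is cut off at the vertex `v`. -/
def vertexCone (P : Set E3) (v : E3) : Set E3 :=
  convexHull ℝ (vertexFigure P v ∪ {v})

/-- Three-dimensional volume. -/
def vol (S : Set E3) : ℝ := MeasureTheory.volume.real S

end Rectification

end

/-!
If every vertex figure `P / v` is flat, rectification truncates `P` at each vertex `v` by the plane
through the midpoints of the edges at `v`. The cones cut off overlap only in null sets, which gives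
the volume. The vertices of the rectification are the edge midpoints, and its edges are the vertex
figures of the facets of `P`, one for each incident pair of a vertex and a facet; each edge of `P`
has two ends and two facets, so there are `2 * f₁` such pairs. The number of facets follows from
Euler's formula, which is proved by sweeping the polyhedron with a hyperplane and counting the
edges and the facets that the hyperplane crosses between two vertices.

The vertex figures of a semiregular polyhedron are flat because all vertices have the same distance
from their centroid and all edges at a vertex have the same length.
-/

noncomputable section

namespace Rectification

open Module Filter Topology

section ConvexSets

variable {E : Type*} [AddCommGroup E] [Module ℝ E] {P : Set E} {a b x y : E}

/-- The smallest face of the convex set `P` that contains `x`: the points `y` of `P` for which the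
segment `[y, x]` can be prolonged beyond `x` inside `P`. It lets faces be handled through a point of
their relative interior. -/
def minFace (P : Set E) (x : E) : Set E :=
  {y | y ∈ P ∧ ∃ ε > (0 : ℝ), x + ε • (x - y) ∈ P}

theorem minFace_subset : minFace P x ⊆ P := fun _ hy => hy.1

theorem self_mem_minFace (hx : x ∈ P) : x ∈ minFace P x :=
  ⟨hx, 1, one_pos, by simpa⟩

theorem exists_prolongation_mem_minFace (hy : y ∈ minFace P x) :
    ∃ ε > (0 : ℝ), x + ε • (x - y) ∈ minFace P x := by
  obtain ⟨hyP, ε, hε, hε'⟩ := hy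
  refine ⟨ε, hε, hε', ε⁻¹, by positivity, ?_⟩
  convert hyP using 1
  rw [sub_add_cancel_left, smul_neg, smul_smul, inv_mul_cancel₀ hε.ne']
  module

theorem left_mem_minFace_of_mem_openSegment (ha : a ∈ P) (hb : b ∈ P)
    (hx : x ∈ openSegment ℝ a b) : a ∈ minFace P x := by
  obtain ⟨α, β, hα, hβ, hαβ, rfl⟩ := hx
  obtain rfl : α = 1 - β := by linarith
  refine ⟨ha, (1 - β) / β, by positivity, ?_⟩
  convert hb using 1
  match_scalars <;> field_simp <;> ring

theorem right_mem_minFace_of_mem_openSegment (ha : a ∈ P) (hb : b ∈ P)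
    (hx : x ∈ openSegment ℝ a b) : b ∈ minFace P x :=
  left_mem_minFace_of_mem_openSegment hb ha (openSegment_symm ℝ a b ▸ hx)

theorem minFace_eq_singleton_of_mem_extremePoints (hx : x ∈ P.extremePoints ℝ) :
    minFace P x = {x} := by
  refine Set.Subset.antisymm ?_ (Set.singleton_subset_iff.2 (self_mem_minFace hx.1))
  rintro y ⟨hy, ε, hε, hy'⟩
  refine hx.2 hy hy' ⟨ε / (1 + ε), 1 / (1 + ε), by positivity, by positivity, ?_, ?_⟩
  · field_simp
    ring
  · match_scalars <;> field_simp
    ring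

theorem eventually_add_smul_mem (hP : Convex ℝ P) {δ ε : ℝ} (hδ : 0 < δ) (hε : 0 < ε)
    (hδP : x - δ • y ∈ P) (hεP : x + ε • y ∈ P) : ∀ᶠ t in 𝓝 (0 : ℝ), x + t • y ∈ P := by
  have hline : Convex ℝ {t : ℝ | x + t • y ∈ P} := by
    have := hP.affine_preimage (AffineMap.lineMap (k := ℝ) x (x + y))
    simpa [Set.preimage, AffineMap.lineMap_apply, add_comm x] using this
  filter_upwards [Icc_mem_nhds (neg_lt_zero.2 hδ) hε] with t ht
  exact hline.ordConnected.out (by simpa [sub_eq_add_neg] using hδP) hεP ht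

theorem exists_add_sub_smul_mem_of_eventually (h : ∀ᶠ t in 𝓝 (0 : ℝ), x + t • y ∈ P) :
    ∃ ε > (0 : ℝ), x + ε • y ∈ P ∧ x - ε • y ∈ P := by
  have hneg : ∀ᶠ t in 𝓝 (0 : ℝ), x + (-t) • y ∈ P :=
    (continuous_neg.tendsto' (0 : ℝ) 0 neg_zero).eventually h
  obtain ⟨ε, ⟨h1, h2⟩, hε⟩ := (((h.and hneg).filter_mono nhdsWithin_le_nhds).and
    (self_mem_nhdsWithin : Set.Ioi (0 : ℝ) ∈ 𝓝[>] 0)).exists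
  exact ⟨ε, hε, h1, by simpa [sub_eq_add_neg] using h2⟩

theorem mem_vectorSpan_minFace (hP : Convex ℝ P) (hx : x ∈ P) :
    y ∈ vectorSpan ℝ (minFace P x) ↔ ∀ᶠ t in 𝓝 (0 : ℝ), x + t • y ∈ P := by
  have tendsto_mul_const (a : ℝ) : Tendsto (fun t : ℝ => t * a) (𝓝 0) (𝓝 0) :=
    (continuous_mul_const a).tendsto' 0 0 (zero_mul a)
  rw [vectorSpan_eq_span_vsub_set_right ℝ (self_mem_minFace hx)]
  constructor
  · intro hy
    induction hy using Submodule.span_induction with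
    | mem y hy =>
      obtain ⟨z, ⟨hz, ε, hε, hz'⟩, rfl⟩ := hy
      refine eventually_add_smul_mem hP hε one_pos ?_ (by simpa using hz)
      simpa only [vsub_eq_sub, sub_eq_add_neg, ← smul_neg, neg_add_rev, neg_neg] using hz'
    | zero => simpa using hx
    | add y z _ _ hy hz =>
      filter_upwards [(tendsto_mul_const 2).eventually hy, (tendsto_mul_const 2).eventually hz]
        with t hyt hzt
      convert hP.midpoint_mem hyt hzt using 1
      rw [midpoint_eq_smul_add]
      match_scalars <;> simp only [invOf_eq_inv] <;> ring
    | smul a y _ hy =>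
      filter_upwards [(tendsto_mul_const a).eventually hy] with t ht
      rwa [smul_smul]
  · intro hy
    obtain ⟨ε, hε, hadd, hsub⟩ := exists_add_sub_smul_mem_of_eventually hy
    have hmem : ε • y ∈ Submodule.span ℝ ((· -ᵥ x) '' minFace P x) := by
      refine Submodule.subset_span ⟨x + ε • y, ⟨hadd, 1, one_pos, ?_⟩, by simp⟩
      convert hsub using 1
      module
    exact (Submodule.smul_mem_iff _ hε.ne').1 hmem

theorem mem_minFace_of_sub_mem_vectorSpan (hP : Convex ℝ P) {z : E} (hx : x ∈ P) (hz : z ∈ P)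
    (h : z - x ∈ vectorSpan ℝ (minFace P x)) : z ∈ minFace P x := by
  obtain ⟨ε, hε, -, hsub⟩ :=
    exists_add_sub_smul_mem_of_eventually ((mem_vectorSpan_minFace hP hx).1 h)
  refine ⟨hz, ε, hε, ?_⟩
  convert hsub using 1
  module

theorem finrank_vectorSpan_segment (h : a ≠ b) :
    finrank ℝ (vectorSpan ℝ (segment ℝ a b)) = 1 := by
  rw [vectorSpan_segment, vsub_eq_sub, finrank_span_singleton (sub_ne_zero.2 h.symm)]

theorem nonempty_of_finrank_vectorSpan_ne_zero (h : finrank ℝ (vectorSpan ℝ P) ≠ 0) :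
    P.Nonempty := by
  by_contra hP
  rw [Set.not_nonempty_iff_eq_empty.1 hP, vectorSpan_empty, finrank_bot] at h
  exact h rfl

theorem minFace_subset_of_isExposed [TopologicalSpace E] {F : Set E} (h : IsExposed ℝ P F)
    (hx : x ∈ F) : minFace P x ⊆ F := by
  obtain ⟨l, rfl⟩ := h ⟨x, hx⟩
  rintro y ⟨hy, ε, hε, hy'⟩
  refine ⟨hy, fun z hz => (hx.2 z hz).trans ?_⟩
  have hle := hx.2 _ hy'
  rw [map_add, map_smul, map_sub, smul_eq_mul, add_le_iff_nonpos_right] at hle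
  exact sub_nonpos.1 (nonpos_of_mul_nonpos_right hle hε)

theorem minFace_of_isExposed [TopologicalSpace E] {F : Set E} (h : IsExposed ℝ P F) (hx : x ∈ F) :
    minFace F x = minFace P x := by
  refine Set.Subset.antisymm (fun y ⟨hy, ε, hε, hy'⟩ => ⟨h.subset hy, ε, hε, h.subset hy'⟩)
    fun y hy => ⟨minFace_subset_of_isExposed h hx hy, ?_⟩
  obtain ⟨ε, hε, hmem⟩ := exists_prolongation_mem_minFace hy
  exact ⟨ε, hε, minFace_subset_of_isExposed h hx hmem⟩

end ConvexSets

section InnerProductSpace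

variable {E : Type*} [NormedAddCommGroup E] [InnerProductSpace ℝ E] {P : Set E} {g x y : E}
  {c : ℝ} {H : Set (E × ℝ)}

theorem exists_inner_of_isExposed [CompleteSpace E] {F : Set E} (hF : F.Nonempty)
    (h : IsExposed ℝ P F) :
    ∃ (g : E) (c : ℝ), (∀ y ∈ P, inner ℝ g y ≤ c) ∧ F = {x ∈ P | inner ℝ g x = c} := by
  obtain ⟨l, rfl⟩ := h hF
  obtain ⟨w, hw, hmax⟩ := hF
  refine ⟨(InnerProductSpace.toDual ℝ E).symm l, l w, by simpa using hmax, ?_⟩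
  ext x
  simp only [InnerProductSpace.toDual_symm_apply, Set.mem_ofPred_eq, and_congr_right_iff]
  exact fun hx => ⟨fun h => le_antisymm (hmax x hx) (h w hw), fun h y hy => h ▸ hmax y hy⟩

theorem isExposed_of_inner_le (h : ∀ y ∈ P, inner ℝ g y ≤ c) :
    IsExposed ℝ P {x ∈ P | inner ℝ g x = c} := by
  rintro ⟨w, hw, rfl⟩
  refine ⟨innerSL ℝ g, ?_⟩
  ext x
  simp only [innerSL_apply_apply, Set.mem_ofPred_eq, and_congr_right_iff]
  exact fun hx => ⟨fun e y hy => e ▸ h y hy, fun h' => le_antisymm (h x hx) (h' w hw)⟩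

theorem convex_inner_le (g : E) (c : ℝ) : Convex ℝ {x : E | inner ℝ g x ≤ c} :=
  convex_halfSpace_le (innerₛₗ ℝ g).isLinear c

theorem finrank_inf_ker_add_one [FiniteDimensional ℝ E] {V : Submodule ℝ E} {d : E} (hd : d ∈ V)
    (hgd : inner ℝ g d ≠ 0) :
    finrank ℝ ↥(V ⊓ LinearMap.ker (innerₛₗ ℝ g)) + 1 = finrank ℝ V := by
  have hne : (innerₛₗ ℝ g).domRestrict V ≠ 0 := fun h => hgd (by
    simpa using LinearMap.congr_fun h ⟨d, hd⟩)
  rw [← Module.Dual.finrank_ker_add_one_of_ne_zero (f := (innerₛₗ ℝ g).domRestrict V) hne,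
    LinearMap.ker_domRestrict, ← Submodule.map_comap_subtype, Submodule.finrank_map_subtype_eq]

theorem finrank_vectorSpan_lt_of_inner_eq [FiniteDimensional ℝ E] {F : Set E} (hg : g ≠ 0)
    (h : ∀ x ∈ F, inner ℝ g x = c) : finrank ℝ (vectorSpan ℝ F) < finrank ℝ E := by
  have hle : vectorSpan ℝ F ≤ ⊤ ⊓ LinearMap.ker (innerₛₗ ℝ g) := by
    rw [top_inf_eq, vectorSpan_def, Submodule.span_le]
    rintro _ ⟨x, hx, y, hy, rfl⟩
    simp [inner_sub_right, h x hx, h y hy]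
  have hker := finrank_inf_ker_add_one (V := ⊤) (g := g) (d := g) trivial (by simpa using hg)
  rw [finrank_top] at hker
  exact hker ▸ Nat.lt_succ_of_le (Submodule.finrank_mono hle)

/-- The constraints `⟪h.1, ·⟫ ≤ h.2` of the system `H` that are tight at `x`. -/
def active (H : Set (E × ℝ)) (x : E) : Set (E × ℝ) := {h ∈ H | inner ℝ h.1 x = h.2}

theorem exists_add_smul_mem (hH : H.Finite) (hx : ∀ h ∈ H, inner ℝ h.1 x ≤ h.2)
    (hy : ∀ h ∈ active H x, inner ℝ h.1 y ≤ 0) :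
    ∃ ε > (0 : ℝ), ∀ h ∈ H, inner ℝ h.1 (x + ε • y) ≤ h.2 := by
  have hle : ∀ h ∈ H, ∀ᶠ ε in 𝓝[>] (0 : ℝ), inner ℝ h.1 (x + ε • y) ≤ h.2 := by
    intro h hh
    rcases (hx h hh).eq_or_lt with htight | hslack
    · filter_upwards [self_mem_nhdsWithin] with ε hε
      rw [inner_add_right, inner_smul_right, htight]
      have := mul_nonpos_of_nonneg_of_nonpos (le_of_lt hε) (hy h ⟨hh, htight⟩)
      linarith
    · have hcont : Continuous fun ε : ℝ => inner ℝ h.1 (x + ε • y) := by fun_prop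
      have hlt : ∀ᶠ ε in 𝓝 (0 : ℝ), inner ℝ h.1 (x + ε • y) < h.2 :=
        hcont.continuousAt.eventually_lt continuousAt_const (by simpa using hslack)
      exact (hlt.filter_mono nhdsWithin_le_nhds).mono fun _ => le_of_lt
  obtain ⟨ε, hε, hpos⟩ := (((eventually_all_finite hH).2 hle).and self_mem_nhdsWithin).exists
  exact ⟨ε, hpos, hε⟩

theorem minFace_eq_active (hH : H.Finite) (hx : ∀ h ∈ H, inner ℝ h.1 x ≤ h.2) :
    minFace {x | ∀ h ∈ H, inner ℝ h.1 x ≤ h.2} x =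
      {y | (∀ h ∈ H, inner ℝ h.1 y ≤ h.2) ∧ ∀ h ∈ active H x, inner ℝ h.1 y = h.2} := by
  ext y
  constructor
  · rintro ⟨hy, ε, hε, hy'⟩
    refine ⟨hy, fun h hh => le_antisymm (hy h hh.1) ?_⟩
    have := hy' h hh.1
    rw [inner_add_right, inner_smul_right, inner_sub_right, hh.2] at this
    nlinarith
  · rintro ⟨hy, hy'⟩
    exact ⟨hy, exists_add_smul_mem hH hx (y := x - y) fun h hh => by
      rw [inner_sub_right, hh.2, hy' h hh, sub_self]⟩

/-- The section of `P` by the hyperplane `⟪g, x⟫ = c`. -/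
def slice (P : Set E) (g : E) (c : ℝ) : Set E := {x ∈ P | inner ℝ g x = c}

/-- `F` has points strictly on both sides of the hyperplane `⟪g, x⟫ = c`. -/
def Crosses (g : E) (c : ℝ) (F : Set E) : Prop :=
  (∃ y ∈ F, inner ℝ g y < c) ∧ ∃ z ∈ F, c < inner ℝ g z

theorem minFace_slice (hx : inner ℝ g x = c) :
    minFace (slice P g c) x = slice (minFace P x) g c := by
  ext y
  constructor
  · rintro ⟨⟨hy, hc⟩, ε, hε, h⟩
    exact ⟨⟨hy, ε, hε, h.1⟩, hc⟩
  · rintro ⟨⟨hy, ε, hε, h⟩, hc⟩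
    refine ⟨⟨hy, hc⟩, ε, hε, h, ?_⟩
    rw [inner_add_right, inner_smul_right, inner_sub_right, hx, hc, sub_self, mul_zero, add_zero]

theorem convex_slice (hP : Convex ℝ P) (g : E) (c : ℝ) : Convex ℝ (slice P g c) :=
  hP.inter (convex_hyperplane (innerₛₗ ℝ g).isLinear c)

theorem vectorSpan_slice_minFace (hP : Convex ℝ P) (hxP : x ∈ P) (hx : inner ℝ g x = c) :
    vectorSpan ℝ (slice (minFace P x) g c) =
      vectorSpan ℝ (minFace P x) ⊓ LinearMap.ker (innerₛₗ ℝ g) := by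
  have hmem (t : ℝ) (y : E) : x + t • y ∈ slice P g c ↔ x + t • y ∈ P ∧ t * inner ℝ g y = 0 := by
    simp only [slice, Set.mem_ofPred_eq, inner_add_right, inner_smul_right, hx, add_eq_left]
  rw [← minFace_slice hx]
  ext y
  rw [mem_vectorSpan_minFace (convex_slice hP g c) ⟨hxP, hx⟩, Submodule.mem_inf,
    mem_vectorSpan_minFace hP hxP, LinearMap.mem_ker, innerₛₗ_apply_apply]
  simp only [hmem, eventually_and, and_congr_right_iff]
  refine fun _ => ⟨fun h => ?_, fun h => by simp [h]⟩
  obtain ⟨t, ht, hpos⟩ := ((h.filter_mono nhdsWithin_le_nhds).and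
    (self_mem_nhdsWithin : Set.Ioi (0 : ℝ) ∈ 𝓝[>] 0)).exists
  exact (mul_eq_zero.1 ht).resolve_left (ne_of_gt hpos)

theorem crosses_minFace_iff (hx : inner ℝ g x = c) :
    Crosses g c (minFace P x) ↔ ∃ y ∈ minFace P x, inner ℝ g y ≠ c := by
  refine ⟨fun ⟨⟨y, hy, hlt⟩, _⟩ => ⟨y, hy, hlt.ne⟩, ?_⟩
  rintro ⟨y, hy, hne⟩
  obtain ⟨ε, hε, hz⟩ := exists_prolongation_mem_minFace hy
  have hzval : inner ℝ g (x + ε • (x - y)) = c + ε * (c - inner ℝ g y) := by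
    rw [inner_add_right, inner_smul_right, inner_sub_right, hx]
  rcases lt_or_gt_of_ne hne with hlt | hgt
  · exact ⟨⟨y, hy, hlt⟩, _, hz, by nlinarith⟩
  · exact ⟨⟨_, hz, by nlinarith⟩, y, hy, hgt⟩

theorem finrank_slice_minFace_eq_iff [FiniteDimensional ℝ E] (hP : Convex ℝ P) (hxP : x ∈ P)
    (hx : inner ℝ g x = c) {j : ℕ} :
    finrank ℝ (vectorSpan ℝ (slice (minFace P x) g c)) = j ↔
      (finrank ℝ (vectorSpan ℝ (minFace P x)) = j + 1 ∧ Crosses g c (minFace P x)) ∨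
        (finrank ℝ (vectorSpan ℝ (minFace P x)) = j ∧ ∀ y ∈ minFace P x, inner ℝ g y = c) := by
  rw [crosses_minFace_iff hx]
  by_cases hflat : ∀ y ∈ minFace P x, inner ℝ g y = c
  · have hslice : slice (minFace P x) g c = minFace P x := Set.sep_eq_self_iff_mem_true.2 hflat
    have hcross : ¬∃ y ∈ minFace P x, inner ℝ g y ≠ c := by simpa using hflat
    rw [hslice]
    exact ⟨fun h => Or.inr ⟨h, hflat⟩, fun h => (h.resolve_left fun h' => hcross h'.2).1⟩
  · have hcross : ∃ y ∈ minFace P x, inner ℝ g y ≠ c := by simpa using hflat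
    obtain ⟨y, hy, hne⟩ := id hcross
    have hrank := finrank_inf_ker_add_one (g := g)
      (vsub_mem_vectorSpan ℝ hy (self_mem_minFace hxP)) (by
        rwa [vsub_eq_sub, inner_sub_right, hx, sub_ne_zero])
    rw [vectorSpan_slice_minFace hP hxP hx, ← hrank, Nat.add_right_cancel_iff]
    exact ⟨fun h => Or.inl ⟨h, hcross⟩, fun h => (h.resolve_right fun h' => hflat h'.2).1⟩

theorem exists_mem_openSegment_inner_eq {y z : E} (hy : inner ℝ g y < c) (hz : c < inner ℝ g z) :
    ∃ w ∈ openSegment ℝ y z, inner ℝ g w = c := by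
  have himage : openSegment ℝ (inner ℝ g y) (inner ℝ g z) =
      innerₛₗ ℝ g '' openSegment ℝ y z :=
    (image_openSegment ℝ (innerₛₗ ℝ g).toAffineMap y z).symm
  have hc : c ∈ openSegment ℝ (inner ℝ g y) (inner ℝ g z) := by
    rw [openSegment_eq_Ioo (hy.trans hz)]
    exact ⟨hy, hz⟩
  simpa [himage] using hc

end InnerProductSpace

section Cone

variable {E : Type*} [AddCommGroup E] [Module ℝ E] {C : Set E}

theorem convex_setOf_eq_add_smul_sub (hC : Convex ℝ C) (v : E) :
    Convex ℝ {y | ∃ t > (0 : ℝ), ∃ p ∈ C, y = v + t • (p - v)} := by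
  have himage := hC.translate (-v)
  convert (ConvexCone.hull ℝ ((fun p => -v + p) '' C)).convex.translate_preimage_right (-v) using 1
  ext y
  rw [Set.mem_preimage, SetLike.mem_coe, ConvexCone.mem_hull_of_convex himage]
  simp only [Set.mem_smul_set, exists_exists_and_eq_and, Set.mem_image, Set.mem_ofPred_eq,
    gt_iff_lt, neg_add_eq_sub, eq_sub_iff_add_eq', eq_comm (a := y)]

end Cone

theorem exists_injOn_inner {E : Type*} [NormedAddCommGroup E] [InnerProductSpace ℝ E]
    [FiniteDimensional ℝ E] {V : Set E} (hV : V.Finite) : ∃ g : E, V.InjOn (inner ℝ g) := by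
  have : Finite V := hV
  obtain ⟨f, hf⟩ := Module.exists_dual_forall_apply_ne_zero (K := ℝ)
    (fun p : {p : V × V // p.1 ≠ p.2} => (p.1.1 : E) - p.1.2)
    fun p => sub_ne_zero.2 fun h => p.2 (Subtype.ext h)
  have := FiniteDimensional.complete ℝ E
  refine ⟨(InnerProductSpace.toDual ℝ E).symm (LinearMap.toContinuousLinearMap f),
    fun x hx y hy hxy => ?_⟩
  by_contra hne
  refine hf ⟨(⟨x, hx⟩, ⟨y, hy⟩), fun h => hne (congrArg Subtype.val h)⟩ ?_
  simpa [sub_eq_zero] using hxy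

theorem exists_eq_minFace_of_isExposed {E : Type*} [NormedAddCommGroup E] [NormedSpace ℝ E]
    [FiniteDimensional ℝ E] {P F : Set E} (hP : Convex ℝ P) (hF : F.Nonempty)
    (h : IsExposed ℝ P F) : ∃ x ∈ F, F = minFace P x := by
  obtain ⟨x, hx⟩ := hF.intrinsicInterior (h.convex hP)
  obtain ⟨x', hx', rfl⟩ := mem_intrinsicInterior.1 hx
  refine ⟨x', intrinsicInterior_subset hx, Set.Subset.antisymm (fun y hy => ?_)
    (minFace_subset_of_isExposed h (intrinsicInterior_subset hx))⟩
  have : Nonempty (affineSpan ℝ F) := ⟨x'⟩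
  let y' : affineSpan ℝ F := ⟨y, mem_affineSpan ℝ hy⟩
  have hline : Tendsto (fun t : ℝ => t • (x' -ᵥ y') +ᵥ x') (𝓝[>] 0) (𝓝 x') :=
    (Continuous.tendsto' (by fun_prop) 0 x' (by simp)).mono_left nhdsWithin_le_nhds
  obtain ⟨ε, hmem, hε⟩ := ((hline.eventually (mem_interior_iff_mem_nhds.1 hx')).and
    self_mem_nhdsWithin).exists
  refine ⟨h.subset hy, ε, hε, h.subset ?_⟩
  simpa [y', add_comm] using hmem

section Faces

variable {P F : Set E3} {v w x y z g : E3} {c : ℝ} {i : ℕ}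

theorem IsConvexPolyhedron.convex (hP : IsConvexPolyhedron P) : Convex ℝ P := by
  obtain ⟨-, H, -, -, rfl⟩ := hP
  simp only [Set.ofPred_forall]
  exact convex_iInter₂ fun h _ => convex_inner_le h.1 h.2

theorem IsConvexPolyhedron.inter_hyperplane (hP : IsConvexPolyhedron P) (hg : g ≠ 0) (c : ℝ) :
    IsConvexPolyhedron {x ∈ P | inner ℝ g x = c} := by
  obtain ⟨hcompact, H, hH, hH0, rfl⟩ := hP
  refine ⟨hcompact.inter_right (isClosed_eq (by fun_prop) continuous_const),
    H ∪ {(g, c), (-g, -c)}, hH.union (Set.toFinite _), ?_, ?_⟩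
  · rintro h (hh | rfl | rfl)
    exacts [hH0 h hh, hg, neg_ne_zero.2 hg]
  · ext x
    simp only [Set.mem_ofPred_eq, Set.mem_union, Set.mem_insert_iff, Set.mem_singleton_iff,
      or_imp, forall_and, forall_eq, inner_neg_left, neg_le_neg_iff, le_antisymm_iff]

theorem IsConvexPolyhedron.of_isExposed (hP : IsConvexPolyhedron P) (hF : F.Nonempty)
    (h : IsExposed ℝ P F) : IsConvexPolyhedron F := by
  obtain ⟨g, c, -, rfl⟩ := exists_inner_of_isExposed hF h
  rcases eq_or_ne g 0 with rfl | hg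
  · obtain ⟨w, -, hw⟩ := hF
    rwa [Set.sep_eq_self_iff_mem_true.2 fun x _ => by simpa using hw]
  · exact hP.inter_hyperplane hg c

theorem IsConvexPolyhedron.of_mem_faces (hP : IsConvexPolyhedron P) (hF : F ∈ faces P i) :
    IsConvexPolyhedron F :=
  hP.of_isExposed hF.1 hF.2.1

theorem IsConvexPolyhedron.isExposed_minFace (hP : IsConvexPolyhedron P) (hx : x ∈ P) :
    IsExposed ℝ P (minFace P x) := by
  obtain ⟨-, H, hH, -, rfl⟩ := hP
  rw [minFace_eq_active hH hx]
  have hfin : (active H x).Finite := hH.subset fun h hh => hh.1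
  have hsub : active H x ⊆ H := fun h hh => hh.1
  generalize active H x = A at hfin hsub
  clear hx
  induction A, hfin using Set.Finite.induction_on with
  | empty => simpa using IsExposed.refl _
  | @insert a s _ _ ih =>
    have hinter := (ih fun h hh => hsub (Set.mem_insert_of_mem _ hh)).inter
      (isExposed_of_inner_le fun y hy => hy a (hsub (Set.mem_insert _ _)))
    refine (congrArg (IsExposed ℝ _) (Set.ext fun y => ?_)).mpr hinter
    simp only [Set.mem_insert_iff, forall_eq_or_imp, Set.mem_ofPred_eq, Set.mem_inter_iff]
    tauto

theorem IsConvexPolyhedron.mem_faces_iff (hP : IsConvexPolyhedron P) :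
    F ∈ faces P i ↔ ∃ x ∈ P, F = minFace P x ∧ finrank ℝ (vectorSpan ℝ F) = i := by
  constructor
  · rintro ⟨hF, hexp, hdim⟩
    obtain ⟨x, hx, rfl⟩ := exists_eq_minFace_of_isExposed hP.convex hF hexp
    exact ⟨x, hx.1, rfl, hdim⟩
  · rintro ⟨x, hx, rfl, hdim⟩
    exact ⟨⟨x, self_mem_minFace hx⟩, hP.isExposed_minFace hx, hdim⟩

theorem IsConvexPolyhedron.finite_faces (hP : IsConvexPolyhedron P) (i : ℕ) :
    (faces P i).Finite := by
  obtain ⟨-, H, hH, -, hPH⟩ := id hP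
  refine (hH.finite_subsets.image fun A => {y | y ∈ P ∧ ∀ h ∈ A, inner ℝ h.1 y = h.2}).subset ?_
  intro F hF
  obtain ⟨x, hx, rfl, -⟩ := hP.mem_faces_iff.1 hF
  refine ⟨active H x, fun h hh => hh.1, ?_⟩
  subst hPH
  exact (minFace_eq_active hH hx).symm

theorem minFace_subset_of_mem_faces (hF : F ∈ faces P i) (hx : x ∈ F) : minFace P x ⊆ F :=
  minFace_subset_of_isExposed hF.2.1 hx

theorem subset_of_mem_faces (hF : F ∈ faces P i) : F ⊆ P := hF.2.1.subset

theorem IsConvexPolyhedron.minFace_subset_minFace (hP : IsConvexPolyhedron P) (hx : x ∈ P)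
    (hy : y ∈ minFace P x) : minFace P y ⊆ minFace P x :=
  minFace_subset_of_isExposed (hP.isExposed_minFace hx) hy

theorem IsConvexPolyhedron.minFace_eq_of_mem_openSegment (hP : IsConvexPolyhedron P) (hx : x ∈ P)
    (hz : z ∈ minFace P x) (hw : w ∈ openSegment ℝ x z) : minFace P w = minFace P x := by
  have hwx : w ∈ minFace P x := ((hP.isExposed_minFace hx).convex hP.convex).openSegment_subset
    (self_mem_minFace hx) hz hw
  exact (hP.minFace_subset_minFace hx hwx).antisymm
    (hP.minFace_subset_minFace hwx.1 (left_mem_minFace_of_mem_openSegment hx hz.1 hw))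

theorem IsConvexPolyhedron.eq_of_subset_of_mem_faces {G : Set E3} (hP : IsConvexPolyhedron P)
    (hF : F ∈ faces P i) (hG : G ∈ faces P i) (h : F ⊆ G) : F = G := by
  obtain ⟨x, hx, rfl, hxi⟩ := hP.mem_faces_iff.1 hF
  obtain ⟨z, hz, rfl, hzi⟩ := hP.mem_faces_iff.1 hG
  have hspan : vectorSpan ℝ (minFace P x) = vectorSpan ℝ (minFace P z) :=
    Submodule.eq_of_le_of_finrank_eq (vectorSpan_mono ℝ h) (hxi.trans hzi.symm)
  refine h.antisymm (hP.minFace_subset_minFace hx ?_)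
  refine mem_minFace_of_sub_mem_vectorSpan hP.convex hx hz ?_
  exact hspan ▸ vsub_mem_vectorSpan ℝ (self_mem_minFace hz) (h (self_mem_minFace hx))

theorem IsConvexPolyhedron.faces_of_mem_faces (hP : IsConvexPolyhedron P) (hF : F ∈ faces P i)
    (j : ℕ) : faces F j = {G ∈ faces P j | G ⊆ F} := by
  ext G
  rw [(hP.of_mem_faces hF).mem_faces_iff, Set.mem_ofPred_eq, hP.mem_faces_iff]
  constructor
  · rintro ⟨x, hx, rfl, hdim⟩
    exact ⟨⟨x, hF.2.1.subset hx, minFace_of_isExposed hF.2.1 hx, hdim⟩, minFace_subset⟩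
  · rintro ⟨⟨x, hx, rfl, hdim⟩, hsub⟩
    have hxF := hsub (self_mem_minFace hx)
    exact ⟨x, hxF, (minFace_of_isExposed hF.2.1 hxF).symm, hdim⟩

end Faces

section Vertices

variable {P F e : Set E3} {u v w a b g : E3} {c : ℝ} {i : ℕ}

theorem vertices_subset : vertices P ⊆ P := fun _ hv => hv.2.1.subset (Set.mem_singleton _)

theorem vertices_subset_extremePoints : vertices P ⊆ P.extremePoints ℝ := fun _ hv =>
  isExtreme_singleton.1 hv.2.1.isExtreme

theorem IsConvexPolyhedron.vertices_eq_extremePoints (hP : IsConvexPolyhedron P) :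
    vertices P = P.extremePoints ℝ := by
  refine vertices_subset_extremePoints.antisymm fun v hv => hP.mem_faces_iff.2 ⟨v, hv.1, ?_, ?_⟩
  · exact (minFace_eq_singleton_of_mem_extremePoints hv).symm
  · rw [vectorSpan_singleton, finrank_bot]

theorem eq_or_eq_of_mem_segment_of_mem_vertices (hu : u ∈ vertices P) (ha : a ∈ P) (hb : b ∈ P)
    (h : u ∈ segment ℝ a b) : a = u ∨ b = u :=
  (mem_extremePoints_iff_forall_segment.1 (vertices_subset_extremePoints hu)).2 a ha b hb h

theorem faces_zero : faces P 0 = (fun v => ({v} : Set E3)) '' vertices P := by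
  refine Set.Subset.antisymm (fun F hF => ?_) (Set.image_subset_iff.2 fun v hv => hv)
  obtain ⟨x, hx⟩ := hF.1
  have hsub : F.Subsingleton :=
    (vectorSpan_eq_bot_iff_subsingleton ℝ).1 (Submodule.finrank_eq_zero.1 hF.2.2)
  obtain rfl := hsub.eq_singleton_of_mem hx
  exact ⟨x, hF, rfl⟩

theorem fNumber_zero : fNumber P 0 = (vertices P).ncard := by
  rw [fNumber, faces_zero, Set.ncard_image_of_injective _ Set.singleton_injective]

theorem IsConvexPolyhedron.finite_vertices (hP : IsConvexPolyhedron P) : (vertices P).Finite :=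
  (faces_zero ▸ hP.finite_faces 0).of_finite_image Set.singleton_injective.injOn

theorem IsConvexPolyhedron.vertices_of_mem_faces (hP : IsConvexPolyhedron P)
    (hF : F ∈ faces P i) : vertices F = {v ∈ vertices P | v ∈ F} := by
  ext v
  simp only [vertices, hP.faces_of_mem_faces hF, Set.mem_ofPred_eq, Set.singleton_subset_iff]

theorem IsConvexPolyhedron.convexHull_vertices (hP : IsConvexPolyhedron P) :
    convexHull ℝ (vertices P) = P := by
  rw [← (hP.finite_vertices.isClosed_convexHull ℝ).closure_eq, hP.vertices_eq_extremePoints,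
    closure_convexHull_extremePoints hP.1 hP.convex]

theorem IsConvexPolyhedron.nonempty_vertices (hP : IsConvexPolyhedron P) (h : P.Nonempty) :
    (vertices P).Nonempty := by
  rwa [← convexHull_nonempty_iff (𝕜 := ℝ), hP.convexHull_vertices]

theorem IsConvexPolyhedron.inner_le_of_vertices (hP : IsConvexPolyhedron P)
    (h : ∀ u ∈ vertices P, inner ℝ g u ≤ c) : ∀ y ∈ P, inner ℝ g y ≤ c := by
  intro y hy
  rw [← hP.convexHull_vertices] at hy
  exact convexHull_min (fun u hu => h u hu) (convex_inner_le g c) hy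

theorem IsConvexPolyhedron.exists_vertex_max (hP : IsConvexPolyhedron P) (hne : P.Nonempty)
    (g : E3) : ∃ u ∈ vertices P, ∀ y ∈ P, inner ℝ g y ≤ inner ℝ g u := by
  obtain ⟨u, hu, hmax⟩ := hP.finite_vertices.exists_maximalFor (fun u => inner ℝ g u) _
    (hP.nonempty_vertices hne)
  exact ⟨u, hu, hP.inner_le_of_vertices fun w hw => (le_total _ _).elim id (hmax hw)⟩

theorem IsConvexPolyhedron.exists_vertex_min (hP : IsConvexPolyhedron P) (hne : P.Nonempty)
    (g : E3) : ∃ u ∈ vertices P, ∀ y ∈ P, inner ℝ g u ≤ inner ℝ g y := by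
  obtain ⟨u, hu, hmax⟩ := hP.exists_vertex_max hne (-g)
  exact ⟨u, hu, fun y hy => by simpa using hmax y hy⟩

theorem IsConvexPolyhedron.exists_vertex_ne (hP : IsConvexPolyhedron P)
    (hd : finrank ℝ (vectorSpan ℝ P) ≠ 0) (v : E3) : ∃ u ∈ vertices P, u ≠ v := by
  by_contra! h
  have hsub : P ⊆ {v} := by
    rw [← hP.convexHull_vertices, ← convexHull_singleton (𝕜 := ℝ) v]
    exact convexHull_mono h
  exact hd (by rw [(vectorSpan_eq_bot_iff_subsingleton ℝ).2 (Set.subsingleton_singleton.anti hsub),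
    finrank_bot])

theorem IsConvexPolyhedron.exists_vertex_mem_face (hP : IsConvexPolyhedron P)
    (hF : F ∈ faces P i) : ∃ u ∈ vertices P, u ∈ F := by
  obtain ⟨u, hu⟩ := (hP.of_mem_faces hF).nonempty_vertices hF.1
  exact ⟨u, by rwa [hP.vertices_of_mem_faces hF] at hu⟩

theorem IsConvexPolyhedron.exists_vertex_mem_face_ne (hP : IsConvexPolyhedron P)
    (hF : F ∈ faces P (i + 1)) (v : E3) : ∃ u ∈ vertices P, u ∈ F ∧ u ≠ v := by
  obtain ⟨u, hu, huv⟩ := (hP.of_mem_faces hF).exists_vertex_ne (by simp [hF.2.2]) v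
  rw [hP.vertices_of_mem_faces hF] at hu
  exact ⟨u, hu.1, hu.2, huv⟩

theorem vertices_eq_pair (hd : finrank ℝ (vectorSpan ℝ P) = 1) (ha : a ∈ vertices P)
    (hb : b ∈ vertices P) (hab : a ≠ b) : vertices P = {a, b} := by
  refine Set.Subset.antisymm (fun u hu => ?_) (Set.pair_subset ha hb)
  have hcol : Collinear ℝ {a, b, u} := (collinear_iff_finrank_le_one.2 hd.le).subset <| by
    simp [Set.insert_subset_iff, vertices_subset ha, vertices_subset hb, vertices_subset hu]
  rcases hcol.wbtw_or_wbtw_or_wbtw with h | h | h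
  · have := eq_or_eq_of_mem_segment_of_mem_vertices hb (vertices_subset ha) (vertices_subset hu)
      (mem_segment_iff_wbtw.2 h)
    exact Or.inr (this.resolve_left hab)
  · have := eq_or_eq_of_mem_segment_of_mem_vertices hu (vertices_subset hb) (vertices_subset ha)
      (mem_segment_iff_wbtw.2 h)
    exact this.symm.imp Eq.symm Eq.symm
  · have := eq_or_eq_of_mem_segment_of_mem_vertices ha (vertices_subset hu) (vertices_subset hb)
      (mem_segment_iff_wbtw.2 h)
    exact Or.inl (this.resolve_right hab.symm)

theorem IsConvexPolyhedron.exists_vertices_eq_pair (hP : IsConvexPolyhedron P)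
    (hd : finrank ℝ (vectorSpan ℝ P) = 1) : ∃ a b, a ≠ b ∧ vertices P = {a, b} := by
  obtain ⟨a, ha, -⟩ := hP.exists_vertex_ne (by simp [hd]) 0
  obtain ⟨b, hb, hba⟩ := hP.exists_vertex_ne (by simp [hd]) a
  exact ⟨a, b, hba.symm, vertices_eq_pair hd ha hb hba.symm⟩

end Vertices

section Edges

variable {P e : Set E3} {u v w : E3}

theorem IsConvexPolyhedron.ncard_vertices_of_edge (hP : IsConvexPolyhedron P)
    (he : e ∈ faces P 1) : {v ∈ vertices P | v ∈ e}.ncard = 2 := by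
  obtain ⟨a, b, hab, hV⟩ := (hP.of_mem_faces he).exists_vertices_eq_pair he.2.2
  rw [← hP.vertices_of_mem_faces he, hV, Set.ncard_pair hab]

theorem IsConvexPolyhedron.exists_adj_of_mem_edge (hP : IsConvexPolyhedron P) (he : e ∈ faces P 1)
    (hv : v ∈ vertices P) (hve : v ∈ e) : ∃ w, (graph P).Adj v w ∧ e = segment ℝ v w := by
  obtain ⟨w, hw, hwe, hwv⟩ := hP.exists_vertex_mem_face_ne he v
  have heF := hP.of_mem_faces he
  have hV := vertices_eq_pair he.2.2 (hP.vertices_of_mem_faces he ▸ ⟨hv, hve⟩)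
    (hP.vertices_of_mem_faces he ▸ ⟨hw, hwe⟩) hwv.symm
  have hseg : e = segment ℝ v w := by rw [← heF.convexHull_vertices, hV, convexHull_pair]
  subst hseg
  exact ⟨w, he, rfl⟩

theorem IsConvexPolyhedron.left_mem_vertices_of_adj (hP : IsConvexPolyhedron P)
    (h : (graph P).Adj v w) : v ∈ vertices P := by
  have he : segment ℝ v w ∈ faces P 1 := h
  obtain ⟨u, hu, hue, huw⟩ := hP.exists_vertex_mem_face_ne he w
  have hext : u ∈ (convexHull ℝ {v, w}).extremePoints ℝ := by
    rw [convexHull_pair]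
    exact vertices_subset_extremePoints (hP.vertices_of_mem_faces he ▸ ⟨hu, hue⟩)
  obtain rfl := (extremePoints_convexHull_subset hext).resolve_right huw
  exact hu

theorem IsConvexPolyhedron.right_mem_vertices_of_adj (hP : IsConvexPolyhedron P)
    (h : (graph P).Adj v w) : w ∈ vertices P :=
  hP.left_mem_vertices_of_adj h.symm

theorem IsConvexPolyhedron.eq_or_eq_of_mem_edge (hP : IsConvexPolyhedron P)
    (h : (graph P).Adj v w) (hu : u ∈ vertices P) (hue : u ∈ segment ℝ v w) : v = u ∨ w = u :=
  eq_or_eq_of_mem_segment_of_mem_vertices hu (vertices_subset (hP.left_mem_vertices_of_adj h))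
    (vertices_subset (hP.right_mem_vertices_of_adj h)) hue

end Edges

section Slices

variable {P F : Set E3} {g : E3} {c : ℝ} {i : ℕ}

theorem IsConvexPolyhedron.exists_minFace_eq_of_crosses (hP : IsConvexPolyhedron P)
    (hF : F ∈ faces P i) (h : Crosses g c F) : ∃ x ∈ P, F = minFace P x ∧ inner ℝ g x = c := by
  obtain ⟨x, hx, rfl, -⟩ := hP.mem_faces_iff.1 hF
  have of_mem_openSegment {z w : E3} (hz : z ∈ minFace P x) (hw : w ∈ openSegment ℝ x z)
      (hwc : inner ℝ g w = c) : ∃ x' ∈ P, minFace P x = minFace P x' ∧ inner ℝ g x' = c :=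
    ⟨w, hP.convex.openSegment_subset hx hz.1 hw,
      (hP.minFace_eq_of_mem_openSegment hx hz hw).symm, hwc⟩
  obtain ⟨⟨y, hy, hyc⟩, z, hz, hzc⟩ := h
  rcases lt_trichotomy (inner ℝ g x) c with hlt | heq | hgt
  · obtain ⟨w, hw, hwc⟩ := exists_mem_openSegment_inner_eq hlt hzc
    exact of_mem_openSegment hz hw hwc
  · exact ⟨x, hx, rfl, heq⟩
  · obtain ⟨w, hw, hwc⟩ := exists_mem_openSegment_inner_eq hyc hgt
    exact of_mem_openSegment hy (openSegment_symm ℝ y x ▸ hw) hwc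

theorem IsConvexPolyhedron.bijOn_slice (hP : IsConvexPolyhedron P) (hg : g ≠ 0) (c : ℝ) (j : ℕ) :
    Set.BijOn (fun F => slice F g c)
      ({F ∈ faces P (j + 1) | Crosses g c F} ∪ {F ∈ faces P j | ∀ y ∈ F, inner ℝ g y = c})
      (faces (slice P g c) j) := by
  have hS : IsConvexPolyhedron (slice P g c) := hP.inter_hyperplane hg c
  set S := {F ∈ faces P (j + 1) | Crosses g c F} ∪ {F ∈ faces P j | ∀ y ∈ F, inner ℝ g y = c}
  have minFace_mem_iff {x : E3} (hx : x ∈ P) (hxc : inner ℝ g x = c) :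
      minFace P x ∈ S ↔ slice (minFace P x) g c ∈ faces (slice P g c) j := by
    have hmem (i : ℕ) : minFace P x ∈ faces P i ↔ finrank ℝ (vectorSpan ℝ (minFace P x)) = i :=
      ⟨fun h => h.2.2, fun h => ⟨⟨x, self_mem_minFace hx⟩, hP.isExposed_minFace hx, h⟩⟩
    have hmem' : slice (minFace P x) g c ∈ faces (slice P g c) j ↔
        finrank ℝ (vectorSpan ℝ (slice (minFace P x) g c)) = j :=
      ⟨fun h => h.2.2, fun h => hS.mem_faces_iff.2 ⟨x, ⟨hx, hxc⟩, (minFace_slice hxc).symm, h⟩⟩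
    rw [hmem', finrank_slice_minFace_eq_iff hP.convex hx hxc, ← hmem, ← hmem]
    rfl
  have exists_eq_minFace {F : Set E3} (hF : F ∈ S) :
      ∃ x ∈ P, F = minFace P x ∧ inner ℝ g x = c := by
    rcases hF with ⟨hF, hc⟩ | ⟨hF, hc⟩
    · exact hP.exists_minFace_eq_of_crosses hF hc
    · obtain ⟨x, hx, rfl, -⟩ := hP.mem_faces_iff.1 hF
      exact ⟨x, hx, rfl, hc x (self_mem_minFace hx)⟩
  refine ⟨fun F hF => ?_, fun F hF G hG (h : slice F g c = slice G g c) => ?_, fun G hG => ?_⟩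
  · obtain ⟨x, hx, rfl, hxc⟩ := exists_eq_minFace hF
    exact (minFace_mem_iff hx hxc).1 hF
  · obtain ⟨x, hx, rfl, hxc⟩ := exists_eq_minFace hF
    obtain ⟨z, hz, rfl, hzc⟩ := exists_eq_minFace hG
    have hxz : x ∈ slice (minFace P z) g c := h ▸ ⟨self_mem_minFace hx, hxc⟩
    have hzx : z ∈ slice (minFace P x) g c := h ▸ ⟨self_mem_minFace hz, hzc⟩
    exact (hP.minFace_subset_minFace hz hxz.1).antisymm (hP.minFace_subset_minFace hx hzx.1)
  · obtain ⟨x, ⟨hx, hxc⟩, rfl, -⟩ := hS.mem_faces_iff.1 hG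
    rw [minFace_slice hxc] at hG ⊢
    exact ⟨minFace P x, (minFace_mem_iff hx hxc).2 hG, rfl⟩

end Slices

theorem ncard_mul_eq_ncard_mul {α β : Type*} {s : Set α} {t : Set β} (hs : s.Finite)
    (ht : t.Finite) (r : α → β → Prop) {m n : ℕ} (hm : ∀ a ∈ s, {b ∈ t | r a b}.ncard = m)
    (hn : ∀ b ∈ t, {a ∈ s | r a b}.ncard = n) : s.ncard * m = t.ncard * n := by
  classical
  lift s to Finset α using hs
  lift t to Finset β using ht
  rw [Set.ncard_coe_finset, Set.ncard_coe_finset]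
  refine Finset.card_mul_eq_card_mul r (fun a ha => ?_) fun b hb => ?_
  · rw [← hm a ha, ← Set.ncard_coe_finset, Finset.coe_bipartiteAbove]
    rfl
  · rw [← hn b hb, ← Set.ncard_coe_finset, Finset.coe_bipartiteBelow]
    rfl

section VertexSections

variable {P F e : Set E3} {v x g : E3} {c : ℝ}

/-- The hyperplane `⟪g, x⟫ = c` separates the vertex `v` of `P` from the other vertices. -/
structure CutsOff (P : Set E3) (v g : E3) (c : ℝ) : Prop where
  mem : v ∈ vertices P
  ne_zero : g ≠ 0
  lt : c < inner ℝ g v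
  gt : ∀ u ∈ vertices P, u ≠ v → inner ℝ g u < c

theorem exists_inner_lt_of_mem_vertices (hv : v ∈ vertices P) :
    ∃ g : E3, ∀ y ∈ P, y ≠ v → inner ℝ g y < inner ℝ g v := by
  obtain ⟨g, b, hb, heq⟩ := exists_inner_of_isExposed (Set.singleton_nonempty v) hv.2.1
  have hiff (y : E3) : y = v ↔ y ∈ P ∧ inner ℝ g y = b := by
    rw [← Set.mem_singleton_iff, heq, Set.mem_ofPred_eq]
  have hvb : inner ℝ g v = b := ((hiff v).1 rfl).2
  exact ⟨g, fun y hy hyv => hvb ▸ (hb y hy).lt_of_ne fun h => hyv ((hiff y).2 ⟨hy, h⟩)⟩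

theorem IsConvexPolyhedron.exists_cutsOff (hP : IsConvexPolyhedron P) (hv : v ∈ vertices P)
    (hx : x ∈ P) (hxv : x ≠ v) : ∃ g c, CutsOff P v g c ∧ inner ℝ g x < c := by
  obtain ⟨g, hg⟩ := exists_inner_lt_of_mem_vertices hv
  have hlt : ∀ u ∈ insert x (vertices P \ {v}), inner ℝ g u < inner ℝ g v := by
    rintro y (rfl | ⟨hy, hyv⟩)
    exacts [hg y hx hxv, hg y (vertices_subset hy) hyv]
  obtain ⟨c, hc, hcv⟩ := ((hP.finite_vertices.sdiff.insert x).image (inner ℝ g)).exists_between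
    (s := inner ℝ g '' insert x (vertices P \ {v})) ⟨_, x, Or.inl rfl, rfl⟩
    (Set.finite_singleton (inner ℝ g v)) (Set.singleton_nonempty _)
    (by rintro _ ⟨u, hu, rfl⟩ _ rfl; exact hlt u hu)
  refine ⟨g, c, ⟨hv, ?_, hcv _ rfl, fun u hu huv => hc _ ⟨u, Or.inr ⟨hu, huv⟩, rfl⟩⟩,
    hc _ ⟨x, Or.inl rfl, rfl⟩⟩
  rintro rfl
  simpa using hg x hx hxv

namespace CutsOff

theorem isConvexPolyhedron (h : CutsOff P v g c) (hP : IsConvexPolyhedron P) :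
    IsConvexPolyhedron (slice P g c) := hP.inter_hyperplane h.ne_zero c

theorem crosses_iff (h : CutsOff P v g c) (hP : IsConvexPolyhedron P) {j : ℕ}
    (hF : F ∈ faces P (j + 1)) : Crosses g c F ↔ v ∈ F := by
  constructor
  · rintro ⟨-, z, hz, hzc⟩
    by_contra hv
    refine hzc.not_ge ((hP.of_mem_faces hF).inner_le_of_vertices (fun u hu => ?_) z hz)
    rw [hP.vertices_of_mem_faces hF] at hu
    exact (h.gt u hu.1 (ne_of_mem_of_not_mem hu.2 hv)).le
  · intro hv
    obtain ⟨u, hu, huF, huv⟩ := hP.exists_vertex_mem_face_ne hF v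
    exact ⟨⟨u, huF, h.gt u hu huv⟩, v, hv, h.lt⟩

theorem inner_ne (h : CutsOff P v g c) {u : E3} (hu : u ∈ vertices P) : inner ℝ g u ≠ c := by
  rcases eq_or_ne u v with rfl | huv
  exacts [h.lt.ne', (h.gt u hu huv).ne]

theorem bijOn (h : CutsOff P v g c) (hP : IsConvexPolyhedron P) (j : ℕ) :
    Set.BijOn (fun F => slice F g c) {F ∈ faces P (j + 1) | v ∈ F} (faces (slice P g c) j) := by
  have hflat : {F ∈ faces P j | ∀ y ∈ F, inner ℝ g y = c} = ∅ := by
    refine Set.eq_empty_of_forall_notMem fun F hF => ?_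
    obtain ⟨u, hu, huF⟩ := hP.exists_vertex_mem_face hF.1
    exact h.inner_ne hu (hF.2 u huF)
  have hcross : {F ∈ faces P (j + 1) | v ∈ F} = {F ∈ faces P (j + 1) | Crosses g c F} :=
    Set.ext fun F => and_congr_right fun hF => (h.crosses_iff hP hF).symm
  simpa only [hflat, Set.union_empty, hcross] using hP.bijOn_slice h.ne_zero c j

theorem finrank_slice (h : CutsOff P v g c) (hP : IsConvexPolyhedron P) {d : ℕ}
    (hd : finrank ℝ (vectorSpan ℝ P) = d + 1) :
    finrank ℝ (vectorSpan ℝ (slice P g c)) = d :=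
  have hv := vertices_subset h.mem
  ((h.bijOn hP d).mapsTo ⟨⟨⟨v, hv⟩, IsExposed.refl P, hd⟩, hv⟩).2.2

theorem exists_mem_vertices (h : CutsOff P v g c) (hP : IsConvexPolyhedron P)
    (he : e ∈ faces P 1) (hv : v ∈ e) :
    ∃ u ∈ vertices (slice P g c), slice e g c = {u} ∧ e = minFace P u := by
  have hslice : slice e g c ∈ faces (slice P g c) 0 := (h.bijOn hP 0).mapsTo ⟨he, hv⟩
  rw [faces_zero] at hslice
  obtain ⟨u, hu, heu⟩ := hslice
  obtain ⟨x, hx, hex, hxc⟩ := hP.exists_minFace_eq_of_crosses he ((h.crosses_iff hP he).2 hv)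
  have hxe : x ∈ slice e g c := ⟨hex ▸ self_mem_minFace hx, hxc⟩
  rw [← heu] at hxe
  obtain rfl := Set.mem_singleton_iff.1 hxe
  exact ⟨x, hu, heu.symm, hex⟩

theorem minFace_mem_faces (h : CutsOff P v g c) (hP : IsConvexPolyhedron P) {u : E3}
    (hu : u ∈ vertices (slice P g c)) : minFace P u ∈ faces P 1 ∧ v ∈ minFace P u := by
  obtain ⟨e, ⟨he, hv⟩, heu : slice e g c = {u}⟩ := (h.bijOn hP 0).surjOn hu
  obtain ⟨u', -, heu', rfl⟩ := h.exists_mem_vertices hP he hv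
  obtain rfl := Set.singleton_injective (heu.symm.trans heu')
  exact ⟨he, hv⟩

end CutsOff

theorem IsConvexPolyhedron.ncard_edges_at_vertex (hP : IsConvexPolyhedron P)
    (hd : finrank ℝ (vectorSpan ℝ P) = 2) (hv : v ∈ vertices P) :
    {e ∈ faces P 1 | v ∈ e}.ncard = 2 := by
  obtain ⟨u, hu, huv⟩ := hP.exists_vertex_ne (by simp [hd]) v
  obtain ⟨g, c, h, -⟩ := hP.exists_cutsOff hv (vertices_subset hu) huv
  obtain ⟨a, b, hab, hV⟩ :=
    (h.isConvexPolyhedron hP).exists_vertices_eq_pair (h.finrank_slice hP hd)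
  rw [(h.bijOn hP 0).ncard_eq, ← Set.ncard_pair hab, ← hV]
  exact fNumber_zero

theorem IsConvexPolyhedron.ncard_edges_of_flag (hP : IsConvexPolyhedron P) (hF : F ∈ faces P 2)
    (hv : v ∈ vertices P) (hvF : v ∈ F) : {e ∈ faces P 1 | v ∈ e ∧ e ⊆ F}.ncard = 2 := by
  have hvF' : v ∈ vertices F := hP.vertices_of_mem_faces hF ▸ ⟨hv, hvF⟩
  rw [← (hP.of_mem_faces hF).ncard_edges_at_vertex hF.2.2 hvF', hP.faces_of_mem_faces hF]
  congr 1
  ext e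
  simp only [Set.mem_ofPred_eq]
  tauto

theorem IsConvexPolyhedron.ncard_facets_of_edge (hP : IsConvexPolyhedron P)
    (hd : finrank ℝ (vectorSpan ℝ P) = 3) (he : e ∈ faces P 1) :
    {F ∈ faces P 2 | e ⊆ F}.ncard = 2 := by
  obtain ⟨v, hv, hve⟩ := hP.exists_vertex_mem_face he
  obtain ⟨w, hw, -, hwv⟩ := hP.exists_vertex_mem_face_ne he v
  obtain ⟨g, c, h, -⟩ := hP.exists_cutsOff hv (vertices_subset hw) hwv
  obtain ⟨u, hu, hue, heu⟩ := h.exists_mem_vertices hP he hve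
  have hu' : u ∈ slice e g c := hue ▸ Set.mem_singleton u
  refine Eq.trans ?_
    ((h.isConvexPolyhedron hP).ncard_edges_at_vertex (h.finrank_slice hP hd) hu)
  refine Set.BijOn.ncard_eq (f := fun F => slice F g c) ⟨?_, ?_, ?_⟩
  · exact fun F ⟨hF, heF⟩ => ⟨(h.bijOn hP 1).mapsTo ⟨hF, heF hve⟩, heF hu'.1, hu'.2⟩
  · exact fun F hF G hG => (h.bijOn hP 1).injOn ⟨hF.1, hF.2 hve⟩ ⟨hG.1, hG.2 hve⟩
  · rintro G ⟨hG, huG⟩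
    obtain ⟨F, ⟨hF, -⟩, rfl⟩ := (h.bijOn hP 1).surjOn hG
    exact ⟨F, ⟨hF, heu ▸ minFace_subset_of_mem_faces hF huG.1⟩, rfl⟩

theorem IsConvexPolyhedron.ncard_edges_eq (hP : IsConvexPolyhedron P)
    (hd : finrank ℝ (vectorSpan ℝ P) = 2) : (faces P 1).ncard = (faces P 0).ncard := by
  have hcount := ncard_mul_eq_ncard_mul hP.finite_vertices (hP.finite_faces 1) (fun v e => v ∈ e)
    (fun v hv => hP.ncard_edges_at_vertex hd hv) fun e he => hP.ncard_vertices_of_edge he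
  have hzero : (faces P 0).ncard = (vertices P).ncard := fNumber_zero
  omega

end VertexSections

section Connectivity

variable {P : Set E3} {v x g : E3} {c : ℝ}

theorem CutsOff.slice_subset (h : CutsOff P v g c) (hP : IsConvexPolyhedron P) :
    slice P g c ⊆
      {y | ∃ t > (0 : ℝ), ∃ p ∈ convexHull ℝ ((graph P).neighborSet v), y = v + t • (p - v)} := by
  rw [← (h.isConvexPolyhedron hP).convexHull_vertices]
  refine convexHull_min (fun u hu => ?_)
    (convex_setOf_eq_add_smul_sub (convex_convexHull ℝ _) v)
  obtain ⟨he, hve⟩ := h.minFace_mem_faces hP hu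
  obtain ⟨w, hw, hew⟩ := hP.exists_adj_of_mem_edge he h.mem hve
  obtain ⟨huP, huc⟩ := vertices_subset hu
  have huw : u ∈ segment ℝ v w := hew ▸ self_mem_minFace huP
  rw [segment_eq_image'] at huw
  obtain ⟨t, ⟨ht, -⟩, rfl⟩ := huw
  refine ⟨t, ht.lt_of_ne ?_, w, subset_convexHull ℝ _ hw, rfl⟩
  rintro rfl
  simp only [zero_smul, add_zero] at huc
  exact h.lt.ne' huc

theorem CutsOff.exists_mem_slice (h : CutsOff P v g c) (hP : IsConvexPolyhedron P) (hx : x ∈ P)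
    (hxc : inner ℝ g x < c) : ∃ t > (0 : ℝ), v + t • (x - v) ∈ slice P g c := by
  obtain ⟨y, hy, hyc⟩ := exists_mem_openSegment_inner_eq hxc h.lt
  rw [openSegment_symm, openSegment_eq_image'] at hy
  obtain ⟨t, ht, rfl⟩ := hy
  exact ⟨t, ht.1, hP.convex.add_smul_sub_mem (vertices_subset h.mem) hx ⟨ht.1.le, ht.2.le⟩, hyc⟩

theorem IsConvexPolyhedron.mem_cone_of_mem (hP : IsConvexPolyhedron P) (hv : v ∈ vertices P)
    (hx : x ∈ P) (hxv : x ≠ v) :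
    ∃ t > (0 : ℝ), ∃ p ∈ convexHull ℝ ((graph P).neighborSet v), x = v + t • (p - v) := by
  obtain ⟨g, c, h, hxc⟩ := hP.exists_cutsOff hv hx hxv
  obtain ⟨s, hs, hmem⟩ := h.exists_mem_slice hP hx hxc
  obtain ⟨t, ht, p, hp, hsp⟩ := h.slice_subset hP hmem
  refine ⟨t / s, div_pos ht hs, p, hp, ?_⟩
  rw [div_eq_inv_mul, mul_smul, ← add_left_cancel hsp, inv_smul_smul₀ hs.ne', add_sub_cancel]

theorem IsConvexPolyhedron.inner_le_of_adj (hP : IsConvexPolyhedron P) (hv : v ∈ vertices P)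
    (h : ∀ w, (graph P).Adj v w → inner ℝ g w ≤ inner ℝ g v) (hx : x ∈ P) :
    inner ℝ g x ≤ inner ℝ g v := by
  rcases eq_or_ne x v with rfl | hxv
  · exact le_rfl
  obtain ⟨t, ht, p, hp, rfl⟩ := hP.mem_cone_of_mem hv hx hxv
  have hpv : inner ℝ g p ≤ inner ℝ g v := convexHull_min h (convex_inner_le g _) hp
  rw [inner_add_right, inner_smul_right, inner_sub_right]
  linarith [mul_nonneg ht.le (sub_nonneg.2 hpv)]

-- Among the vertices satisfying `Q`, one that is highest in the direction exposing `b` has no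
-- higher neighbour, hence is `b`.
theorem IsConvexPolyhedron.forall_vertices_of_adj (hP : IsConvexPolyhedron P) {Q : E3 → Prop}
    (hQ : ∀ u w, (graph P).Adj u w → Q u → Q w) (hv : v ∈ vertices P) (hQv : Q v) :
    ∀ b ∈ vertices P, Q b := by
  intro b hb
  obtain ⟨g, hg⟩ := exists_inner_lt_of_mem_vertices hb
  obtain ⟨u, ⟨hu, hQu⟩, hmax⟩ := (hP.finite_vertices.subset (Set.sep_subset _ Q)).exists_maximalFor
    (inner ℝ g) _ ⟨v, hv, hQv⟩
  have hbu : inner ℝ g b ≤ inner ℝ g u := by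
    refine hP.inner_le_of_adj hu (fun w hw => ?_) (vertices_subset hb)
    by_contra! hlt
    exact hlt.not_ge (hmax ⟨hP.right_mem_vertices_of_adj hw, hQ u w hw hQu⟩ hlt.le)
  by_contra hQb
  exact (hg u (vertices_subset hu) (by rintro rfl; exact hQb hQu)).not_ge hbu

-- The edges and facets at `v` are the vertices and edges of a section close to `v`, whose graph
-- is connected.
theorem IsConvexPolyhedron.forall_edges_at_vertex (hP : IsConvexPolyhedron P)
    {Q : Set E3 → Prop} (hv : v ∈ vertices P)
    (hQ : ∀ F ∈ faces P 2, ∀ e ∈ faces P 1, ∀ e' ∈ faces P 1, v ∈ e → v ∈ e' → e ⊆ F → e' ⊆ F →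
      Q e → Q e') {e₀ : Set E3} (he₀ : e₀ ∈ faces P 1) (hve₀ : v ∈ e₀) (hQe₀ : Q e₀) :
    ∀ e ∈ faces P 1, v ∈ e → Q e := by
  intro e he hve
  obtain ⟨w, hw, -, hwv⟩ := hP.exists_vertex_mem_face_ne he v
  obtain ⟨g, c, h, -⟩ := hP.exists_cutsOff hv (vertices_subset hw) hwv
  have hT := h.isConvexPolyhedron hP
  obtain ⟨u₀, hu₀, -, rfl⟩ := h.exists_mem_vertices hP he₀ hve₀
  obtain ⟨u, hu, -, rfl⟩ := h.exists_mem_vertices hP he hve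
  refine hT.forall_vertices_of_adj (Q := fun u => Q (minFace P u)) (fun a b hab ha => ?_) hu₀ hQe₀
    u hu
  obtain ⟨F, ⟨hF, -⟩, hFab : slice F g c = segment ℝ a b⟩ := (h.bijOn hP 1).surjOn hab
  obtain ⟨hea, hva⟩ := h.minFace_mem_faces hP (hT.left_mem_vertices_of_adj hab)
  obtain ⟨heb, hvb⟩ := h.minFace_mem_faces hP (hT.right_mem_vertices_of_adj hab)
  have haF : a ∈ slice F g c := hFab ▸ left_mem_segment ℝ a b
  have hbF : b ∈ slice F g c := hFab ▸ right_mem_segment ℝ a b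
  exact hQ F hF _ hea _ heb hva hvb (minFace_subset_of_mem_faces hF haF.1)
    (minFace_subset_of_mem_faces hF hbF.1) ha

end Connectivity

section Sweep

variable {P F : Set E3} {v g : E3} {c : ℝ} {i : ℕ}

/-- The `i`-faces of `P` whose lowest point in the direction `g` is `v`: a hyperplane sweeping
`P` in the direction `g` starts crossing them when it passes `v`. -/
def bottomFaces (P : Set E3) (g : E3) (i : ℕ) (v : E3) : Set (Set E3) :=
  {F ∈ faces P i | v ∈ F ∧ ∀ y ∈ F, inner ℝ g v ≤ inner ℝ g y}

theorem IsConvexPolyhedron.exists_vertex_min_of_mem_faces (hP : IsConvexPolyhedron P)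
    (hF : F ∈ faces P i) (g : E3) :
    ∃ u ∈ vertices P, u ∈ F ∧ ∀ y ∈ F, inner ℝ g u ≤ inner ℝ g y := by
  obtain ⟨u, hu, h⟩ := (hP.of_mem_faces hF).exists_vertex_min hF.1 g
  rw [hP.vertices_of_mem_faces hF] at hu
  exact ⟨u, hu.1, hu.2, h⟩

theorem IsConvexPolyhedron.exists_vertex_max_of_mem_faces (hP : IsConvexPolyhedron P)
    (hF : F ∈ faces P i) (g : E3) :
    ∃ u ∈ vertices P, u ∈ F ∧ ∀ y ∈ F, inner ℝ g y ≤ inner ℝ g u := by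
  obtain ⟨u, hu, h⟩ := (hP.of_mem_faces hF).exists_vertex_max hF.1 g
  rw [hP.vertices_of_mem_faces hF] at hu
  exact ⟨u, hu.1, hu.2, h⟩

theorem IsConvexPolyhedron.sum_ncard_bottomFaces (hP : IsConvexPolyhedron P)
    (hg : (vertices P).InjOn (inner ℝ g)) (i : ℕ) :
    ∑ v ∈ hP.finite_vertices.toFinset, (bottomFaces P g i v).ncard = (faces P i).ncard := by
  classical
  have hcount := Finset.sum_card_bipartiteAbove_eq_sum_card_bipartiteBelow
    (s := hP.finite_vertices.toFinset) (t := (hP.finite_faces i).toFinset)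
    (fun v F => v ∈ F ∧ ∀ y ∈ F, inner ℝ g v ≤ inner ℝ g y)
  rw [Set.ncard_eq_toFinset_card _ (hP.finite_faces i), Finset.card_eq_sum_ones]
  refine Eq.trans (Finset.sum_congr rfl fun v _ => ?_)
    (hcount.trans (Finset.sum_congr rfl fun F hF => ?_))
  · rw [← Set.ncard_coe_finset, Finset.coe_bipartiteAbove]
    simp only [Set.Finite.mem_toFinset]
    rfl
  · rw [Set.Finite.mem_toFinset] at hF
    obtain ⟨u, hu, huF, hmin⟩ := hP.exists_vertex_min_of_mem_faces hF g
    rw [Finset.card_eq_one]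
    refine ⟨u, Finset.ext fun w => ?_⟩
    simp only [Finset.mem_bipartiteBelow, Set.Finite.mem_toFinset, Finset.mem_singleton]
    constructor
    · rintro ⟨hw, hwF, hwmin⟩
      exact hg hw hu ((hwmin u huF).antisymm (hmin w hwF))
    · rintro rfl
      exact ⟨hu, huF, hmin⟩

theorem ncard_faces_zero_sep (P : Set E3) (g : E3) (c : ℝ) :
    {F ∈ faces P 0 | ∀ y ∈ F, inner ℝ g y = c}.ncard =
      {v ∈ vertices P | inner ℝ g v = c}.ncard := by
  rw [← Set.ncard_image_of_injective {v ∈ vertices P | inner ℝ g v = c} Set.singleton_injective,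
    faces_zero]
  congr 1
  ext F
  simp only [Set.mem_ofPred_eq, Set.mem_image]
  constructor
  · rintro ⟨⟨v, hv, rfl⟩, h⟩
    exact ⟨v, ⟨hv, h v rfl⟩, rfl⟩
  · rintro ⟨v, ⟨hv, h⟩, rfl⟩
    exact ⟨⟨v, hv, rfl⟩, by rintro y rfl; exact h⟩

-- The hyperplane section is a polygon, which has as many edges as vertices.
theorem IsConvexPolyhedron.ncard_crosses (hP : IsConvexPolyhedron P)
    (hd : finrank ℝ (vectorSpan ℝ P) = 3) (hg : (vertices P).InjOn (inner ℝ g))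
    (hc : Crosses g c P) :
    {F ∈ faces P 2 | Crosses g c F}.ncard =
      {F ∈ faces P 1 | Crosses g c F}.ncard + {v ∈ vertices P | inner ℝ g v = c}.ncard := by
  have hg0 : g ≠ 0 := by
    rintro rfl
    obtain ⟨⟨y, -, hy⟩, z, -, hz⟩ := hc
    rw [inner_zero_left] at hy hz
    exact hy.asymm hz
  have hPP : P ∈ faces P 3 := ⟨let ⟨⟨y, hy, _⟩, _⟩ := hc; ⟨y, hy⟩, IsExposed.refl P, hd⟩
  have hT : IsConvexPolyhedron (slice P g c) := hP.inter_hyperplane hg0 c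
  have hpolygon := hT.ncard_edges_eq ((hP.bijOn_slice hg0 c 2).mapsTo (Or.inl ⟨hPP, hc⟩)).2.2
  have hflat : {F ∈ faces P 1 | ∀ y ∈ F, inner ℝ g y = c} = ∅ := by
    refine Set.eq_empty_of_forall_notMem fun F hF => ?_
    obtain ⟨u, hu, huF⟩ := hP.exists_vertex_mem_face hF.1
    obtain ⟨w, hw, hwF, hwu⟩ := hP.exists_vertex_mem_face_ne hF.1 u
    exact hwu (hg hw hu ((hF.2 w hwF).trans (hF.2 u huF).symm))
  have hdisj : Disjoint {F ∈ faces P 1 | Crosses g c F}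
      {F ∈ faces P 0 | ∀ y ∈ F, inner ℝ g y = c} := by
    rw [Set.disjoint_left]
    rintro F ⟨-, ⟨y, hy, hyc⟩, -⟩ ⟨-, hF⟩
    exact hyc.ne (hF y hy)
  rw [← (hP.bijOn_slice hg0 c 0).ncard_eq, ← (hP.bijOn_slice hg0 c 1).ncard_eq, hflat,
    Set.union_empty, Set.ncard_union_eq hdisj ((hP.finite_faces 1).subset fun F hF => hF.1)
    ((hP.finite_faces 0).subset fun F hF => hF.1), ncard_faces_zero_sep] at hpolygon
  exact hpolygon

theorem IsConvexPolyhedron.crosses_iff_of_lt (hP : IsConvexPolyhedron P)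
    (hg : (vertices P).InjOn (inner ℝ g)) (hv : v ∈ vertices P) (hc : inner ℝ g v < c)
    (hgap : ∀ u ∈ vertices P, inner ℝ g v < inner ℝ g u → c < inner ℝ g u)
    (hF : F ∈ faces P (i + 1)) :
    Crosses g c F ↔ Crosses g (inner ℝ g v) F ∨ v ∈ F ∧ ∀ y ∈ F, inner ℝ g v ≤ inner ℝ g y := by
  constructor
  · rintro ⟨⟨y, hy, hyc⟩, z, hz, hzc⟩
    obtain ⟨u, hu, huF, hmin⟩ := hP.exists_vertex_min_of_mem_faces hF g
    rcases lt_trichotomy (inner ℝ g u) (inner ℝ g v) with hlt | heq | hgt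
    · exact Or.inl ⟨⟨u, huF, hlt⟩, z, hz, hc.trans hzc⟩
    · obtain rfl := hg hu hv heq
      exact Or.inr ⟨huF, hmin⟩
    · exact absurd ((hmin y hy).trans_lt hyc) (hgap u hu hgt).not_gt
  · rintro (⟨⟨y, hy, hyc⟩, z, hz, hzc⟩ | ⟨hvF, hmin⟩)
    · obtain ⟨u, hu, huF, hmax⟩ := hP.exists_vertex_max_of_mem_faces hF g
      exact ⟨⟨y, hy, hyc.trans hc⟩, u, huF, hgap u hu (hzc.trans_le (hmax z hz))⟩
    · obtain ⟨u, hu, huF, huv⟩ := hP.exists_vertex_mem_face_ne hF v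
      exact ⟨⟨v, hvF, hc⟩, u, huF,
        hgap u hu ((hmin u huF).lt_of_ne fun h => huv (hg hu hv h.symm))⟩

theorem IsConvexPolyhedron.ncard_crosses_of_lt (hP : IsConvexPolyhedron P)
    (hg : (vertices P).InjOn (inner ℝ g)) (hv : v ∈ vertices P) (hc : inner ℝ g v < c)
    (hgap : ∀ u ∈ vertices P, inner ℝ g v < inner ℝ g u → c < inner ℝ g u) (i : ℕ) :
    {F ∈ faces P (i + 1) | Crosses g c F}.ncard =
      {F ∈ faces P (i + 1) | Crosses g (inner ℝ g v) F}.ncard +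
        (bottomFaces P g (i + 1) v).ncard := by
  rw [← Set.ncard_union_eq ?_ ((hP.finite_faces _).subset fun F hF => hF.1)
    ((hP.finite_faces _).subset fun F hF => hF.1)]
  · congr 1
    ext F
    simp only [bottomFaces, Set.mem_union, Set.mem_ofPred_eq, ← and_or_left]
    exact and_congr_right fun hF => hP.crosses_iff_of_lt hg hv hc hgap hF
  · rw [Set.disjoint_left]
    rintro F ⟨-, ⟨y, hy, hyc⟩, -⟩ ⟨-, -, hF⟩
    exact hyc.not_ge (hF y hy)

theorem IsConvexPolyhedron.bottomFaces_eq_empty (hP : IsConvexPolyhedron P)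
    (hg : (vertices P).InjOn (inner ℝ g)) (hv : v ∈ vertices P)
    (hmax : ∀ y ∈ P, inner ℝ g y ≤ inner ℝ g v) (i : ℕ) : bottomFaces P g (i + 1) v = ∅ := by
  refine Set.eq_empty_of_forall_notMem fun F ⟨hF, _, hmin⟩ => ?_
  obtain ⟨u, hu, huF, huv⟩ := hP.exists_vertex_mem_face_ne hF v
  exact huv (hg hu hv ((hmax u (vertices_subset hu)).antisymm (hmin u huF)))

-- The number of crossed facets minus the number of crossed edges is `0` just above `v`.
theorem IsConvexPolyhedron.ncard_bottomFaces_of_exists_lt (hP : IsConvexPolyhedron P)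
    (hd : finrank ℝ (vectorSpan ℝ P) = 3) (hg : (vertices P).InjOn (inner ℝ g))
    (hv : v ∈ vertices P) (hlt : ∃ u ∈ vertices P, inner ℝ g v < inner ℝ g u) :
    {F ∈ faces P 2 | Crosses g (inner ℝ g v) F}.ncard + (bottomFaces P g 2 v).ncard =
      {F ∈ faces P 1 | Crosses g (inner ℝ g v) F}.ncard + (bottomFaces P g 1 v).ncard := by
  obtain ⟨top, htop, hvtop⟩ := hlt
  obtain ⟨c, hvc, hgap⟩ := (Set.finite_singleton (inner ℝ g v)).exists_between
    (Set.singleton_nonempty _)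
    ((hP.finite_vertices.subset (Set.sep_subset _ fun u => inner ℝ g v < inner ℝ g u)).image
      (inner ℝ g)) ⟨_, top, ⟨htop, hvtop⟩, rfl⟩ (by rintro _ rfl _ ⟨u, hu, rfl⟩; exact hu.2)
  have hvc : inner ℝ g v < c := hvc _ rfl
  have hgap : ∀ u ∈ vertices P, inner ℝ g v < inner ℝ g u → c < inner ℝ g u :=
    fun u hu hvu => hgap _ ⟨u, ⟨hu, hvu⟩, rfl⟩
  have hempty : {u ∈ vertices P | inner ℝ g u = c} = ∅ :=
    Set.eq_empty_of_forall_notMem fun u ⟨hu, huc⟩ => (hgap u hu (huc ▸ hvc)).ne' huc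
  have hcross := hP.ncard_crosses hd hg (c := c)
    ⟨⟨v, vertices_subset hv, hvc⟩, top, vertices_subset htop, hgap top htop hvtop⟩
  rwa [hempty, Set.ncard_empty, add_zero, hP.ncard_crosses_of_lt hg hv hvc hgap 1,
    hP.ncard_crosses_of_lt hg hv hvc hgap 0] at hcross

theorem IsConvexPolyhedron.ncard_bottomFaces_of_min (hP : IsConvexPolyhedron P)
    (hd : finrank ℝ (vectorSpan ℝ P) = 3) (hg : (vertices P).InjOn (inner ℝ g))
    (hv : v ∈ vertices P) (hmin : ∀ y ∈ P, inner ℝ g v ≤ inner ℝ g y) :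
    (bottomFaces P g 2 v).ncard = (bottomFaces P g 1 v).ncard := by
  have hempty (i : ℕ) : {F ∈ faces P i | Crosses g (inner ℝ g v) F} = ∅ :=
    Set.eq_empty_of_forall_notMem fun F ⟨hF, ⟨y, hy, hyc⟩, _⟩ =>
      hyc.not_ge (hmin y (subset_of_mem_faces hF hy))
  obtain ⟨u, hu, huv⟩ := hP.exists_vertex_ne (by simp [hd]) v
  have hcount := hP.ncard_bottomFaces_of_exists_lt hd hg hv
    ⟨u, hu, (hmin u (vertices_subset hu)).lt_of_ne fun h => huv (hg hu hv h.symm)⟩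
  simpa only [hempty, Set.ncard_empty, zero_add] using hcount

theorem IsConvexPolyhedron.ncard_bottomFaces_of_crosses (hP : IsConvexPolyhedron P)
    (hd : finrank ℝ (vectorSpan ℝ P) = 3) (hg : (vertices P).InjOn (inner ℝ g))
    (hv : v ∈ vertices P) (hc : Crosses g (inner ℝ g v) P) :
    (bottomFaces P g 1 v).ncard = (bottomFaces P g 2 v).ncard + 1 := by
  have hlevel : {u ∈ vertices P | inner ℝ g u = inner ℝ g v} = {v} :=
    Set.ext fun u => ⟨fun hu => hg hu.1 hv hu.2, by rintro rfl; exact ⟨hv, rfl⟩⟩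
  have hcross := hP.ncard_crosses hd hg hc
  rw [hlevel, Set.ncard_singleton] at hcross
  obtain ⟨-, z, hz, hvz⟩ := hc
  obtain ⟨top, htop, hmax⟩ := hP.exists_vertex_max ⟨z, hz⟩ g
  have hcount := hP.ncard_bottomFaces_of_exists_lt hd hg hv
    ⟨top, htop, hvz.trans_le (hmax z hz)⟩
  omega

theorem IsConvexPolyhedron.euler_formula (hP : IsConvexPolyhedron P)
    (hd : finrank ℝ (vectorSpan ℝ P) = 3) : fNumber P 1 + 2 = fNumber P 2 + fNumber P 0 := by
  classical
  have hne : P.Nonempty := nonempty_of_finrank_vectorSpan_ne_zero (by simp [hd])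
  obtain ⟨g, hg⟩ := exists_injOn_inner hP.finite_vertices
  obtain ⟨bot, hbot, hmin⟩ := hP.exists_vertex_min hne g
  obtain ⟨top, htop, hmax⟩ := hP.exists_vertex_max hne g
  have hlt {u w : E3} (hu : u ∈ vertices P) (hw : w ∈ vertices P) (hne : u ≠ w)
      (hle : inner ℝ g u ≤ inner ℝ g w) : inner ℝ g u < inner ℝ g w :=
    hle.lt_of_ne fun h => hne (hg hu hw h)
  have hbt : bot ≠ top := by
    rintro rfl
    obtain ⟨u, hu, hub⟩ := hP.exists_vertex_ne (by simp [hd]) bot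
    have huP := vertices_subset hu
    exact hub (hg hu hbot ((hmax u huP).antisymm (hmin u huP)))
  have hlocal : ∀ v ∈ hP.finite_vertices.toFinset,
      (bottomFaces P g 1 v).ncard + ((if v = top then 1 else 0) + if v = bot then 1 else 0) =
        (bottomFaces P g 2 v).ncard + 1 := by
    intro v hv
    rw [Set.Finite.mem_toFinset] at hv
    have hvP := vertices_subset hv
    rcases eq_or_ne v top with rfl | hvt
    · simp [hP.bottomFaces_eq_empty hg hv hmax 0, hP.bottomFaces_eq_empty hg hv hmax 1, hbt.symm]
    rcases eq_or_ne v bot with rfl | hvb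
    · simp [hP.ncard_bottomFaces_of_min hd hg hv hmin, hvt]
    · have hc : Crosses g (inner ℝ g v) P :=
        ⟨⟨bot, vertices_subset hbot, hlt hbot hv hvb.symm (hmin v hvP)⟩,
          top, vertices_subset htop, hlt hv htop hvt (hmax v hvP)⟩
      simp [hP.ncard_bottomFaces_of_crosses hd hg hv hc, hvt, hvb]
  have hsum := Finset.sum_congr rfl hlocal
  rw [Finset.sum_add_distrib, Finset.sum_add_distrib, Finset.sum_add_distrib,
    hP.sum_ncard_bottomFaces hg, hP.sum_ncard_bottomFaces hg, Finset.sum_ite_eq',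
    Finset.sum_ite_eq', if_pos (by simpa using htop), if_pos (by simpa using hbot),
    ← Finset.card_eq_sum_ones, ← Set.ncard_eq_toFinset_card _ hP.finite_vertices] at hsum
  rw [fNumber_zero]
  exact hsum

end Sweep

theorem IsConvexPolyhedron.exists_constraint_of_facet {P : Set E3} {H : Set (E3 × ℝ)}
    (hP : IsConvexPolyhedron P) (hf : H.Finite) (h0 : ∀ h ∈ H, h.1 ≠ 0)
    (hPH : P = {x | ∀ h ∈ H, inner ℝ h.1 x ≤ h.2}) (hd : finrank ℝ (vectorSpan ℝ P) = 3)
    {F : Set E3} (hF : F ∈ faces P 2) : ∃ h ∈ H, F = {x ∈ P | inner ℝ h.1 x = h.2} := by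
  obtain ⟨x, hx, rfl, hi⟩ := hP.mem_faces_iff.1 hF
  have hmin : minFace P x = {y | y ∈ P ∧ ∀ h ∈ active H x, inner ℝ h.1 y = h.2} := by
    subst hPH
    exact minFace_eq_active hf hx
  obtain ⟨h, hh⟩ : (active H x).Nonempty := by
    rw [Set.nonempty_iff_ne_empty]
    intro hempty
    have : minFace P x = P := by rw [hmin, hempty]; simp
    rw [this, hd] at hi
    contradiction
  have hsub : minFace P x ⊆ {y ∈ P | inner ℝ h.1 y = h.2} :=
    fun y hy => ⟨(hmin ▸ hy).1, (hmin ▸ hy).2 h hh⟩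
  refine ⟨h, hh.1, hP.eq_of_subset_of_mem_faces hF ⟨⟨x, hx, hh.2⟩,
    isExposed_of_inner_le fun y hy => ?_, le_antisymm ?_ ?_⟩ hsub⟩
  · exact (hPH ▸ hy : y ∈ {x | ∀ h ∈ H, inner ℝ h.1 x ≤ h.2}) h hh.1
  · have hlt := finrank_vectorSpan_lt_of_inner_eq (h0 h hh.1)
      (F := {y ∈ P | inner ℝ h.1 y = h.2}) fun y hy => hy.2
    rw [finrank_euclideanSpace_fin] at hlt
    omega
  · exact hi ▸ Submodule.finrank_mono (vectorSpan_mono ℝ hsub)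

section InnerProduct

variable {E : Type*} [NormedAddCommGroup E] [InnerProductSpace ℝ E] {s : Set E}

theorem convex_le_inner (g : E) (c : ℝ) : Convex ℝ {x : E | c ≤ inner ℝ g x} :=
  convex_halfSpace_ge (innerₛₗ ℝ g).isLinear c

theorem convex_inner_eq (g : E) (c : ℝ) : Convex ℝ {x : E | inner ℝ g x = c} :=
  convex_hyperplane (innerₛₗ ℝ g).isLinear c

theorem inner_midpoint (g x y : E) :
    inner ℝ g (midpoint ℝ x y) = (inner ℝ g x + inner ℝ g y) / 2 := by
  rw [midpoint_eq_smul_add, invOf_eq_inv, inner_smul_right, inner_add_right, inv_mul_eq_div]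

theorem mem_orthogonal_vectorSpan_iff {p q : E} (hp : p ∈ s) :
    q ∈ (vectorSpan ℝ s)ᗮ ↔ ∀ x ∈ s, inner ℝ q x = inner ℝ q p := by
  rw [vectorSpan_eq_span_vsub_set_right ℝ hp, ← Submodule.span_singleton_le_iff_mem,
    ← Submodule.isOrtho_iff_le, Submodule.isOrtho_comm, Submodule.isOrtho_iff_le,
    Submodule.span_le, Set.image_subset_iff]
  simp only [Set.subset_def, Set.mem_preimage, SetLike.mem_coe,
    Submodule.mem_orthogonal_singleton_iff_inner_right, vsub_eq_sub, inner_sub_right, sub_eq_zero]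

theorem exists_inner_eq_of_notMem {S : AffineSubspace ℝ E} [S.direction.HasOrthogonalProjection]
    {v : E} (hv : v ∉ S) :
    ∃ (g : E) (b : ℝ), inner ℝ g v = b + 1 ∧ ∀ w ∈ S, inner ℝ g w = b := by
  rcases S.eq_bot_or_nonempty with rfl | ⟨p, hp⟩
  · exact ⟨0, -1, by simp, fun w hw => (AffineSubspace.notMem_bot ℝ E w hw).elim⟩
  have hvp : v - p ∉ S.directionᗮᗮ := by
    rw [Submodule.orthogonal_orthogonal]
    exact fun h => hv (by simpa using AffineSubspace.vadd_mem_of_mem_direction h hp)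
  obtain ⟨u, hu, huv⟩ : ∃ u ∈ S.directionᗮ, inner ℝ u (v - p) ≠ 0 := by
    contrapose! hvp
    exact (Submodule.mem_orthogonal _ _).2 hvp
  refine ⟨(inner ℝ u (v - p))⁻¹ • u, inner ℝ ((inner ℝ u (v - p))⁻¹ • u) p, ?_, fun w hw => ?_⟩
  · rw [← sub_eq_iff_eq_add', ← inner_sub_right, real_inner_smul_left, inv_mul_cancel₀ huv]
  · have huw : inner ℝ u (w - p) = 0 :=
      Submodule.inner_left_of_mem_orthogonal (AffineSubspace.vsub_mem_direction hw hp) hu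
    rw [← sub_eq_zero, ← inner_sub_right, real_inner_smul_left, huw, mul_zero]

end InnerProduct

section Rectify

variable {P : Set E3} {v w q m : E3} {a : ℝ}

/-- The midpoints of the edges of `P`, which turn out to be the vertices of the rectification. -/
def edgeMidpoints (P : Set E3) : Set E3 := {m | ∃ v w, (graph P).Adj v w ∧ m = midpoint ℝ v w}

theorem IsConvexPolyhedron.midpoint_mem (hP : IsConvexPolyhedron P) (h : (graph P).Adj v w) :
    midpoint ℝ v w ∈ P :=
  hP.convex.midpoint_mem (vertices_subset (hP.left_mem_vertices_of_adj h))
    (vertices_subset (hP.right_mem_vertices_of_adj h))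

theorem IsConvexPolyhedron.rectify_subset (hP : IsConvexPolyhedron P) : rectify P ⊆ P := by
  refine convexHull_min ?_ hP.convex
  rintro _ ⟨v, w, h, rfl⟩
  exact hP.midpoint_mem h

theorem IsConvexPolyhedron.rectify_inter_sep (hP : IsConvexPolyhedron P) (p : E3 → Prop) :
    rectify P ∩ {x ∈ P | p x} = {x ∈ rectify P | p x} := by
  ext x
  exact ⟨fun hx => ⟨hx.1, hx.2.2⟩, fun hx => ⟨hx.1, hP.rectify_subset hx.1, hx.2⟩⟩

theorem IsConvexPolyhedron.minFace_midpoint (hP : IsConvexPolyhedron P)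
    (h : (graph P).Adj v w) : minFace P (midpoint ℝ v w) = segment ℝ v w := by
  have hv := vertices_subset (hP.left_mem_vertices_of_adj h)
  have hw := vertices_subset (hP.right_mem_vertices_of_adj h)
  have hmid : midpoint ℝ v w ∈ openSegment ℝ v w :=
    ⟨1 / 2, 1 / 2, by norm_num, by norm_num, by norm_num, by
      rw [midpoint_eq_smul_add, invOf_eq_inv]
      module⟩
  refine (minFace_subset_of_mem_faces h (midpoint_mem_segment v w)).antisymm ?_
  exact ((hP.isExposed_minFace (hP.midpoint_mem h)).convex hP.convex).segment_subset
    (left_mem_minFace_of_mem_openSegment hv hw hmid)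
    (right_mem_minFace_of_mem_openSegment hv hw hmid)

theorem IsConvexPolyhedron.bijOn_edgeMidpoints (hP : IsConvexPolyhedron P) :
    Set.BijOn (minFace P) (edgeMidpoints P) (faces P 1) := by
  refine ⟨?_, ?_, fun e he => ?_⟩
  · rintro _ ⟨v, w, h, rfl⟩
    exact hP.minFace_midpoint h ▸ h
  · rintro _ ⟨v, w, h, rfl⟩ _ ⟨v', w', h', rfl⟩ heq
    rw [hP.minFace_midpoint h, hP.minFace_midpoint h'] at heq
    have hv' := hP.eq_or_eq_of_mem_edge h (hP.left_mem_vertices_of_adj h')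
      (heq ▸ left_mem_segment ℝ v' w')
    have hw' := hP.eq_or_eq_of_mem_edge h (hP.right_mem_vertices_of_adj h')
      (heq ▸ right_mem_segment ℝ v' w')
    have hne := h'.ne
    rcases hv' with rfl | rfl <;> rcases hw' with rfl | rfl
    exacts [absurd rfl hne, rfl, midpoint_comm _ _, absurd rfl hne]
  · obtain ⟨v, hv, hve⟩ := hP.exists_vertex_mem_face he
    obtain ⟨w, hvw, rfl⟩ := hP.exists_adj_of_mem_edge he hv hve
    exact ⟨midpoint ℝ v w, ⟨v, w, hvw, rfl⟩, hP.minFace_midpoint hvw⟩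

theorem IsConvexPolyhedron.finite_edgeMidpoints (hP : IsConvexPolyhedron P) :
    (edgeMidpoints P).Finite :=
  (hP.finite_faces 1).of_injOn hP.bijOn_edgeMidpoints.mapsTo hP.bijOn_edgeMidpoints.injOn

theorem IsConvexPolyhedron.convexHull_neighborSet_subset (hP : IsConvexPolyhedron P) (v : E3) :
    convexHull ℝ ((graph P).neighborSet v) ⊆ P :=
  convexHull_min (fun _ hw => vertices_subset (hP.right_mem_vertices_of_adj hw)) hP.convex

theorem IsConvexPolyhedron.exists_adj_ne (hP : IsConvexPolyhedron P)
    (hd : 2 ≤ finrank ℝ (vectorSpan ℝ P)) (hv : v ∈ vertices P) (u : E3) :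
    ∃ w, (graph P).Adj v w ∧ w ≠ u := by
  by_contra! h
  have hcollinear : Collinear ℝ P := by
    refine (collinear_iff_of_mem (vertices_subset hv)).2 ⟨u - v, fun x hx => ?_⟩
    rcases eq_or_ne x v with rfl | hxv
    · exact ⟨0, by simp⟩
    obtain ⟨t, -, p, hp, rfl⟩ := hP.mem_cone_of_mem hv hx hxv
    obtain rfl : p = u := convexHull_min (fun w hw => h w hw) (convex_singleton u) hp
    exact ⟨t, by rw [vadd_eq_add, add_comm]⟩
  have := hcollinear.finrank_le_one
  lia

theorem IsConvexPolyhedron.inner_eq_of_edgeMidpoints (hP : IsConvexPolyhedron P)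
    (hd : 2 ≤ finrank ℝ (vectorSpan ℝ P)) (h : ∀ m ∈ edgeMidpoints P, inner ℝ q m = a) :
    ∀ x ∈ P, inner ℝ q x = a := by
  have hadj (v w : E3) (hvw : (graph P).Adj v w) : inner ℝ q w = 2 * a - inner ℝ q v := by
    have := h _ ⟨v, w, hvw, rfl⟩
    rw [inner_midpoint] at this
    linarith
  have hvertices : vertices P ⊆ {x | inner ℝ q x = a} := by
    intro v hv
    obtain ⟨w, hvw, -⟩ := hP.exists_adj_ne hd hv v
    obtain ⟨u, hwu, huv⟩ := hP.exists_adj_ne hd (hP.right_mem_vertices_of_adj hvw) v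
    obtain ⟨t, ht, p, hp, hup⟩ := hP.mem_cone_of_mem hv
      (vertices_subset (hP.right_mem_vertices_of_adj hwu)) huv
    have hpq : inner ℝ q p = 2 * a - inner ℝ q v :=
      convexHull_min (hadj v) (convex_inner_eq q _) hp
    -- `u` is two edges away from `v`, so `q` takes the same value at both.
    have huq : inner ℝ q u = inner ℝ q v := by
      rw [hadj w u hwu, hadj v w hvw]
      ring
    rw [hup, inner_add_right, inner_smul_right, inner_sub_right, hpq, add_eq_left] at huq
    have := (mul_eq_zero.1 huq).resolve_left ht.ne'
    rw [Set.mem_ofPred_eq]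
    linarith
  rw [← hP.convexHull_vertices]
  exact convexHull_min hvertices (convex_inner_eq q a)

theorem IsConvexPolyhedron.vectorSpan_rectify (hP : IsConvexPolyhedron P)
    (hd : 2 ≤ finrank ℝ (vectorSpan ℝ P)) : vectorSpan ℝ (rectify P) = vectorSpan ℝ P := by
  refine (vectorSpan_mono ℝ hP.rectify_subset).antisymm ?_
  obtain ⟨v, hv⟩ :=
    hP.nonempty_vertices (nonempty_of_finrank_vectorSpan_ne_zero (two_pos.trans_le hd).ne')
  obtain ⟨w, hvw, -⟩ := hP.exists_adj_ne hd hv v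
  have hm : midpoint ℝ v w ∈ rectify P := subset_convexHull ℝ _ ⟨v, w, hvw, rfl⟩
  rw [← Submodule.orthogonal_le_orthogonal_iff]
  intro q hq
  rw [mem_orthogonal_vectorSpan_iff hm] at hq
  rw [mem_orthogonal_vectorSpan_iff (hP.rectify_subset hm)]
  exact hP.inner_eq_of_edgeMidpoints hd fun m hm => hq m (subset_convexHull ℝ _ hm)

theorem vertexFigure_subset_rectify : vertexFigure P v ⊆ rectify P :=
  convexHull_mono fun _ ⟨w, hw, hm⟩ => ⟨v, w, hw, hm⟩

end Rectify

section Truncation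

/-- The vertex figures `P / v` are planar, so that rectifying `P` cuts each vertex off by a
plane. -/
def HasFlatVertexFigures (P : Set E3) : Prop :=
  ∀ v ∈ vertices P, Coplanar ℝ (vertexFigure P v)

/-- Planes `⟪g v, x⟫ = b v` that cut the edges at each vertex `v` of `P` in their midpoints, scaled
so that `v` lies at height `1` above its plane and the neighbours of `v` at height `-1`. -/
structure IsMidpointTruncation (P : Set E3) (g : E3 → E3) (b : E3 → ℝ) : Prop where
  polyhedron : IsConvexPolyhedron P
  inner_self : ∀ v ∈ vertices P, inner ℝ (g v) v = b v + 1
  inner_adj : ∀ v w, (graph P).Adj v w → inner ℝ (g v) w = b v - 1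

variable {P : Set E3} {g : E3 → E3} {b : E3 → ℝ} {v w x m p : E3}

theorem IsConvexPolyhedron.subset_affineSpan_vertexFigure (hP : IsConvexPolyhedron P)
    (hv : v ∈ vertices P) (h : v ∈ affineSpan ℝ (vertexFigure P v)) :
    P ⊆ affineSpan ℝ (vertexFigure P v) := by
  have hneighbor : (graph P).neighborSet v ⊆ affineSpan ℝ (vertexFigure P v) := by
    intro w hw
    have hm : midpoint ℝ v w ∈ affineSpan ℝ (vertexFigure P v) :=
      subset_affineSpan ℝ _ (subset_convexHull ℝ _ ⟨w, hw, rfl⟩)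
    simpa [AffineMap.lineMap_apply, midpoint_eq_smul_add, invOf_eq_inv, smul_sub, smul_smul,
      two_smul] using AffineMap.lineMap_mem (2 : ℝ) h hm
  intro x hx
  rcases eq_or_ne x v with rfl | hxv
  · exact h
  obtain ⟨t, -, p, hp, rfl⟩ := hP.mem_cone_of_mem hv hx hxv
  have := AffineMap.lineMap_mem t h (convexHull_min hneighbor (AffineSubspace.convex _) hp)
  rwa [AffineMap.lineMap_apply, vsub_eq_sub, vadd_eq_add, add_comm] at this

theorem HasFlatVertexFigures.notMem_affineSpan (h : HasFlatVertexFigures P)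
    (hP : IsConvexPolyhedron P) (hd : finrank ℝ (vectorSpan ℝ P) = 3) (hv : v ∈ vertices P) :
    v ∉ affineSpan ℝ (vertexFigure P v) := by
  intro hmem
  have hle := vectorSpan_mono ℝ (hP.subset_affineSpan_vertexFigure hv hmem)
  rw [← AffineSubspace.direction_eq_vectorSpan, direction_affineSpan] at hle
  have := Submodule.finrank_mono hle
  have := (h v hv).finrank_le_two
  lia

theorem HasFlatVertexFigures.exists_isMidpointTruncation (h : HasFlatVertexFigures P)
    (hP : IsConvexPolyhedron P) (hd : finrank ℝ (vectorSpan ℝ P) = 3) :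
    ∃ g b, IsMidpointTruncation P g b := by
  choose! g b hself hfigure using fun v (hv : v ∈ vertices P) =>
    exists_inner_eq_of_notMem (h.notMem_affineSpan hP hd hv)
  refine ⟨g, b, hP, hself, fun v w hvw => ?_⟩
  have hv := hP.left_mem_vertices_of_adj hvw
  have hm := hfigure v hv (midpoint ℝ v w)
    (subset_affineSpan ℝ _ (subset_convexHull ℝ _ ⟨w, hvw, rfl⟩))
  rw [inner_midpoint, hself v hv] at hm
  linarith

theorem midpoint_mem_vertexFigure (hp : p ∈ convexHull ℝ ((graph P).neighborSet v)) :
    midpoint ℝ v p ∈ vertexFigure P v := by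
  have hconv : Convex ℝ (AffineMap.homothety v (⅟2 : ℝ) ⁻¹' vertexFigure P v) :=
    (convex_convexHull ℝ _).affine_preimage _
  have hmem : p ∈ AffineMap.homothety v (⅟2 : ℝ) ⁻¹' vertexFigure P v := by
    refine convexHull_min (fun w hw => ?_) hconv hp
    rw [Set.mem_preimage, homothety_invOf_two]
    exact subset_convexHull ℝ _ ⟨w, hw, rfl⟩
  rwa [Set.mem_preimage, homothety_invOf_two] at hmem

namespace IsMidpointTruncation

theorem inner_midpoint_adj (h : IsMidpointTruncation P g b) (hvw : (graph P).Adj v w) :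
    inner ℝ (g v) (midpoint ℝ v w) = b v := by
  rw [inner_midpoint, h.inner_self v (h.polyhedron.left_mem_vertices_of_adj hvw),
    h.inner_adj v w hvw]
  ring

theorem ne_zero (h : IsMidpointTruncation P g b) (hd : 2 ≤ finrank ℝ (vectorSpan ℝ P))
    (hv : v ∈ vertices P) : g v ≠ 0 := by
  intro hg
  obtain ⟨w, hvw, -⟩ := h.polyhedron.exists_adj_ne hd hv v
  have hself := h.inner_self v hv
  have hadj := h.inner_adj v w hvw
  rw [hg, inner_zero_left] at hself hadj
  linarith

theorem exists_cone (h : IsMidpointTruncation P g b) (hv : v ∈ vertices P) (hx : x ∈ P)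
    (hxv : x ≠ v) :
    ∃ t > (0 : ℝ), ∃ p ∈ convexHull ℝ ((graph P).neighborSet v),
      x = v + t • (p - v) ∧ inner ℝ (g v) x = b v + 1 - 2 * t := by
  obtain ⟨t, ht, p, hp, rfl⟩ := h.polyhedron.mem_cone_of_mem hv hx hxv
  refine ⟨t, ht, p, hp, rfl, ?_⟩
  have hpv : inner ℝ (g v) p = b v - 1 :=
    convexHull_min (h.inner_adj v) (convex_inner_eq (g v) _) hp
  rw [inner_add_right, inner_smul_right, inner_sub_right, h.inner_self v hv, hpv]
  ring

theorem inner_le_of_ne (h : IsMidpointTruncation P g b) (hv : v ∈ vertices P)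
    (hw : w ∈ vertices P) (hvw : w ≠ v) : inner ℝ (g v) w ≤ b v - 1 := by
  obtain ⟨t, ht, p, hp, hwp, hwval⟩ := h.exists_cone hv (vertices_subset hw) hvw
  suffices 1 ≤ t by linarith
  by_contra! hlt
  have hmem : w ∈ segment ℝ v p :=
    ⟨1 - t, t, by linarith, ht.le, by ring, by rw [hwp]; module⟩
  rcases eq_or_eq_of_mem_segment_of_mem_vertices hw (vertices_subset hv)
    (h.polyhedron.convexHull_neighborSet_subset v hp) hmem with rfl | rfl
  · exact hvw rfl
  · have hpv : inner ℝ (g v) p = b v - 1 :=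
      convexHull_min (h.inner_adj v) (convex_inner_eq (g v) _) hp
    linarith

theorem inner_edgeMidpoints_lt (h : IsMidpointTruncation P g b) (hv : v ∈ vertices P)
    (hm : m ∈ edgeMidpoints P) (hvm : v ∉ minFace P m) : inner ℝ (g v) m < b v := by
  obtain ⟨a, c, hac, rfl⟩ := hm
  rw [h.polyhedron.minFace_midpoint hac] at hvm
  have ha := h.inner_le_of_ne hv (h.polyhedron.left_mem_vertices_of_adj hac)
    (fun heq => hvm (heq ▸ left_mem_segment ℝ a c))
  have hc := h.inner_le_of_ne hv (h.polyhedron.right_mem_vertices_of_adj hac)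
    (fun heq => hvm (heq ▸ right_mem_segment ℝ a c))
  rw [inner_midpoint]
  linarith

theorem inner_edgeMidpoints_eq (h : IsMidpointTruncation P g b) (hv : v ∈ vertices P)
    (hm : m ∈ edgeMidpoints P) (hvm : v ∈ minFace P m) : inner ℝ (g v) m = b v := by
  obtain ⟨a, c, hac, rfl⟩ := hm
  rw [h.polyhedron.minFace_midpoint hac] at hvm
  rcases h.polyhedron.eq_or_eq_of_mem_edge hac hv hvm with rfl | rfl
  · exact h.inner_midpoint_adj hac
  · exact midpoint_comm (R := ℝ) a c ▸ h.inner_midpoint_adj hac.symm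

theorem inner_edgeMidpoints_le (h : IsMidpointTruncation P g b) (hv : v ∈ vertices P)
    (hm : m ∈ edgeMidpoints P) : inner ℝ (g v) m ≤ b v := by
  by_cases hvm : v ∈ minFace P m
  exacts [(h.inner_edgeMidpoints_eq hv hm hvm).le, (h.inner_edgeMidpoints_lt hv hm hvm).le]

theorem inner_le_of_edgeMidpoints (h : IsMidpointTruncation P g b) {q : E3} {a : ℝ}
    (ha : ∀ m ∈ edgeMidpoints P, inner ℝ q m ≤ a) (hx : x ∈ P)
    (hxb : ∀ v ∈ vertices P, inner ℝ (g v) x ≤ b v) : inner ℝ q x ≤ a := by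
  have hP := h.polyhedron
  -- Seen from the vertex `v` where `q` is largest, `x` lies beyond the midpoint plane of `v`.
  obtain ⟨v, hv, hmax⟩ := hP.exists_vertex_max ⟨x, hx⟩ q
  have hxv : x ≠ v := by
    rintro rfl
    linarith [hxb x hv, h.inner_self x hv]
  obtain ⟨t, -, p, hp, rfl, hval⟩ := h.exists_cone hv hx hxv
  have hhalf : 1 / 2 ≤ t := by linarith [hxb v hv]
  have hpa : inner ℝ q p ≤ 2 * a - inner ℝ q v := by
    refine convexHull_min (fun w hw => ?_) (convex_inner_le q _) hp
    have hmid := ha _ ⟨v, w, hw, rfl⟩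
    rw [inner_midpoint] at hmid
    rw [Set.mem_ofPred_eq]
    linarith
  have hpv := hmax p (hP.convexHull_neighborSet_subset v hp)
  rw [inner_add_right, inner_smul_right, inner_sub_right]
  nlinarith

theorem rectify_eq (h : IsMidpointTruncation P g b) :
    rectify P = {x ∈ P | ∀ v ∈ vertices P, inner ℝ (g v) x ≤ b v} := by
  refine Set.Subset.antisymm (fun x hx => ⟨h.polyhedron.rectify_subset hx, fun v hv => ?_⟩) ?_
  · exact convexHull_min (fun m hm => h.inner_edgeMidpoints_le hv hm)
      (convex_inner_le (g v) (b v)) hx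
  · rintro x ⟨hx, hxb⟩
    by_contra hxR
    obtain ⟨f, a, hfa, hax⟩ := geometric_hahn_banach_closed_point (convex_convexHull ℝ _)
      (h.polyhedron.finite_edgeMidpoints.isClosed_convexHull ℝ) hxR
    refine hax.not_ge ?_
    rw [← InnerProductSpace.toDual_symm_apply (𝕜 := ℝ)]
    refine h.inner_le_of_edgeMidpoints (fun m hm => ?_) hx hxb
    rw [InnerProductSpace.toDual_symm_apply]
    exact (hfa m (subset_convexHull ℝ _ hm)).le

theorem vertexCone_eq (h : IsMidpointTruncation P g b) (hv : v ∈ vertices P) :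
    vertexCone P v = {x ∈ P | b v ≤ inner ℝ (g v) x} := by
  have hP := h.polyhedron
  refine Set.Subset.antisymm ?_ ?_
  · refine convexHull_min (Set.union_subset (fun m hm => ?_) ?_)
      (hP.convex.inter (convex_le_inner (g v) (b v)))
    · refine ⟨hP.rectify_subset (vertexFigure_subset_rectify hm), ?_⟩
      refine convexHull_min ?_ (convex_le_inner (g v) (b v)) hm
      rintro _ ⟨w, hw, rfl⟩
      exact (h.inner_midpoint_adj hw).ge
    · rintro _ rfl
      exact ⟨vertices_subset hv, by linarith [h.inner_self _ hv]⟩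
  · rintro x ⟨hx, hxb⟩
    have hvertex : v ∈ vertexCone P v := subset_convexHull ℝ _ (Or.inr rfl)
    rcases eq_or_ne x v with rfl | hxv
    · exact hvertex
    obtain ⟨t, ht, p, hp, rfl, hval⟩ := h.exists_cone hv hx hxv
    have hmid : midpoint ℝ v p ∈ vertexCone P v :=
      subset_convexHull ℝ _ (Or.inl (midpoint_mem_vertexFigure hp))
    refine (convex_convexHull ℝ _).segment_subset hvertex hmid
      ⟨1 - 2 * t, 2 * t, by linarith, by linarith, by ring, ?_⟩
    rw [midpoint_eq_smul_add, invOf_eq_inv]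
    module

theorem inner_le_of_mem_vertexCone (h : IsMidpointTruncation P g b) (hv : v ∈ vertices P)
    (hw : w ∈ vertices P) (hvw : v ≠ w) (hx : x ∈ vertexCone P w) : inner ℝ (g v) x ≤ b v := by
  refine convexHull_min (Set.union_subset (fun m hm => ?_) ?_) (convex_inner_le (g v) (b v)) hx
  · have hmem := vertexFigure_subset_rectify hm
    rw [h.rectify_eq] at hmem
    exact hmem.2 v hv
  · rintro _ rfl
    rw [Set.mem_ofPred_eq]
    linarith [h.inner_le_of_ne hv hw hvw.symm]

theorem rectify_union_vertexCones (h : IsMidpointTruncation P g b) :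
    rectify P ∪ ⋃ v ∈ vertices P, vertexCone P v = P := by
  refine Set.Subset.antisymm (Set.union_subset h.polyhedron.rectify_subset
    (Set.iUnion₂_subset fun v hv => ?_)) fun x hx => ?_
  · rw [h.vertexCone_eq hv]
    exact Set.sep_subset _ _
  · by_cases hxb : ∀ v ∈ vertices P, inner ℝ (g v) x ≤ b v
    · exact Or.inl (h.rectify_eq ▸ ⟨hx, hxb⟩)
    · push Not at hxb
      obtain ⟨v, hv, hvx⟩ := hxb
      exact Or.inr (Set.mem_biUnion hv (h.vertexCone_eq hv ▸ ⟨hx, hvx.le⟩))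

end IsMidpointTruncation

end Truncation

section Volume

open MeasureTheory

theorem addHaar_setOf_inner_eq {E : Type*} [NormedAddCommGroup E] [InnerProductSpace ℝ E]
    [FiniteDimensional ℝ E] [MeasurableSpace E] [BorelSpace E] (μ : Measure E)
    [μ.IsAddHaarMeasure] {g : E} (hg : g ≠ 0) (c : ℝ) : μ {x | inner ℝ g x = c} = 0 := by
  refine measure_mono_null (subset_affineSpan ℝ _)
    (Measure.addHaar_affineSubspace μ _ fun htop => ?_)
  have hlt := finrank_vectorSpan_lt_of_inner_eq (F := {x | inner ℝ g x = c}) hg fun _ hx => hx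
  rw [← direction_affineSpan, htop, AffineSubspace.direction_top, finrank_top] at hlt
  exact hlt.false

namespace IsMidpointTruncation

variable {P : Set E3} {g : E3 → E3} {b : E3 → ℝ} {v w : E3}

theorem measurableSet_vertexCone (h : IsMidpointTruncation P g b) (hv : v ∈ vertices P) :
    MeasurableSet (vertexCone P v) := by
  rw [h.vertexCone_eq hv]
  exact (h.polyhedron.1.isClosed.inter
    (isClosed_le continuous_const (innerSL ℝ (g v)).continuous)).measurableSet

theorem aedisjoint_of_inner_le (h : IsMidpointTruncation P g b)
    (hd : 2 ≤ finrank ℝ (vectorSpan ℝ P)) (hv : v ∈ vertices P) {S : Set E3}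
    (hS : ∀ x ∈ S, inner ℝ (g v) x ≤ b v) : AEDisjoint volume S (vertexCone P v) := by
  refine measure_mono_null (fun x hx => ?_)
    (addHaar_setOf_inner_eq volume (h.ne_zero hd hv) (b v))
  rw [h.vertexCone_eq hv] at hx
  exact le_antisymm (hS x hx.1) hx.2.2

theorem vol_rectify (h : IsMidpointTruncation P g b) (hd : 2 ≤ finrank ℝ (vectorSpan ℝ P)) :
    vol (rectify P) = vol P - ∑ᶠ v ∈ vertices P, vol (vertexCone P v) := by
  have hfin := h.polyhedron.finite_vertices
  have hfinite {S : Set E3} (hS : S ⊆ P) : volume S ≠ ⊤ :=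
    ne_top_of_le_ne_top h.polyhedron.1.measure_lt_top.ne (measure_mono hS)
  have hcones : ⋃ v ∈ vertices P, vertexCone P v ⊆ P :=
    Set.subset_union_right.trans h.rectify_union_vertexCones.subset
  have hcone (v) (hv : v ∈ vertices P) : vertexCone P v ⊆ P :=
    (Set.subset_biUnion_of_mem hv).trans hcones
  have hsum : volume.real (⋃ v ∈ vertices P, vertexCone P v) =
      ∑ᶠ v ∈ vertices P, vol (vertexCone P v) := by
    rw [finsum_mem_eq_finite_toFinset_sum _ hfin]
    simp only [← hfin.mem_toFinset]
    refine measureReal_biUnion_finset₀ (fun w hw v hv hwv => ?_)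
      (fun v hv => (h.measurableSet_vertexCone (by simpa using hv)).nullMeasurableSet)
      fun v hv => hfinite (hcone v (by simpa using hv))
    exact h.aedisjoint_of_inner_le hd (by simpa using hv) fun x hx =>
      h.inner_le_of_mem_vertexCone (by simpa using hv) (by simpa using hw) hwv.symm hx
  have hdisjoint : AEDisjoint volume (rectify P) (⋃ v ∈ vertices P, vertexCone P v) := by
    rw [AEDisjoint, Set.inter_iUnion₂, measure_biUnion_null_iff hfin.countable]
    intro v hv
    refine h.aedisjoint_of_inner_le hd hv fun x hx => ?_
    rw [h.rectify_eq] at hx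
    exact hx.2 v hv
  have hunion := measureReal_union₀
    (.biUnion hfin.countable fun v hv => (h.measurableSet_vertexCone hv).nullMeasurableSet)
    hdisjoint (hfinite h.polyhedron.rectify_subset) (hfinite hcones)
  rw [h.rectify_union_vertexCones, hsum] at hunion
  exact eq_sub_of_add_eq hunion.symm

end IsMidpointTruncation

end Volume

section Flags

variable {P F G e : Set E3} {v w x m m' : E3} {i : ℕ}

theorem IsConvexPolyhedron.edge_eq_segment (hP : IsConvexPolyhedron P) (he : e ∈ faces P 1)
    (hv : v ∈ vertices P) (hw : w ∈ vertices P) (hvw : v ≠ w) (hve : v ∈ e) (hwe : w ∈ e) :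
    e = segment ℝ v w := by
  obtain ⟨u, hvu, rfl⟩ := hP.exists_adj_of_mem_edge he hv hve
  rw [(hP.eq_or_eq_of_mem_edge hvu hw hwe).resolve_left hvw]

theorem IsConvexPolyhedron.eq_inter_of_mem_faces (hP : IsConvexPolyhedron P) (he : e ∈ faces P i)
    (hF : F ∈ faces P (i + 1)) (hG : G ∈ faces P (i + 1)) (hFG : F ≠ G) (heF : e ⊆ F)
    (heG : e ⊆ G) : e = F ∩ G := by
  have hsub : e ⊆ F ∩ G := Set.subset_inter heF heG
  have hne : (F ∩ G).Nonempty := he.1.mono hsub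
  have hexp : IsExposed ℝ P (F ∩ G) := hF.2.1.inter hG.2.1
  refine hP.eq_of_subset_of_mem_faces he ⟨hne, hexp, ?_⟩ hsub
  have hle := Submodule.finrank_mono (vectorSpan_mono ℝ (Set.inter_subset_left (s := F) (t := G)))
  have hge := Submodule.finrank_mono (vectorSpan_mono ℝ hsub)
  have hne_succ : finrank ℝ (vectorSpan ℝ (F ∩ G)) ≠ i + 1 := fun h => hFG <|
    (hP.eq_of_subset_of_mem_faces ⟨hne, hexp, h⟩ hF Set.inter_subset_left).symm.trans
      (hP.eq_of_subset_of_mem_faces ⟨hne, hexp, h⟩ hG Set.inter_subset_right)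
  rw [hF.2.2] at hle
  rw [he.2.2] at hge
  exact (Nat.le_of_lt_succ (hle.lt_of_ne hne_succ)).antisymm hge

theorem IsConvexPolyhedron.adj_iff_of_mem_faces (hP : IsConvexPolyhedron P) (hF : F ∈ faces P i) :
    (graph F).Adj v w ↔ (graph P).Adj v w ∧ segment ℝ v w ⊆ F := by
  change _ ∈ faces F 1 ↔ _
  rw [hP.faces_of_mem_faces hF]
  rfl

theorem IsConvexPolyhedron.edgeMidpoints_subset_of_mem_faces (hP : IsConvexPolyhedron P)
    (hF : F ∈ faces P i) : edgeMidpoints F ⊆ edgeMidpoints P :=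
  fun _ ⟨v, w, hvw, hm⟩ => ⟨v, w, ((hP.adj_iff_of_mem_faces hF).1 hvw).1, hm⟩

theorem IsConvexPolyhedron.eq_of_mem_vertices_of_mem_minFace (hP : IsConvexPolyhedron P)
    (hm : m ∈ edgeMidpoints P) (hm' : m' ∈ edgeMidpoints P) (hne : m ≠ m')
    (hv : v ∈ vertices P) (hw : w ∈ vertices P) (hvm : v ∈ minFace P m) (hvm' : v ∈ minFace P m')
    (hwm : w ∈ minFace P m) (hwm' : w ∈ minFace P m') : v = w := by
  have hbij := hP.bijOn_edgeMidpoints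
  by_contra hvw
  refine hne (hbij.injOn hm hm' ?_)
  rw [hP.edge_eq_segment (hbij.mapsTo hm) hv hw hvw hvm hwm,
    hP.edge_eq_segment (hbij.mapsTo hm') hv hw hvw hvm' hwm']

theorem IsConvexPolyhedron.eq_of_mem_facets (hP : IsConvexPolyhedron P)
    (hm : m ∈ edgeMidpoints P) (hm' : m' ∈ edgeMidpoints P) (hne : m ≠ m')
    (hF : F ∈ faces P 2) (hG : G ∈ faces P 2) (hmF : m ∈ F) (hmF' : m' ∈ F)
    (hmG : m ∈ G) (hmG' : m' ∈ G) : F = G := by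
  have hbij := hP.bijOn_edgeMidpoints
  by_contra hFG
  refine hne (hbij.injOn hm hm' ?_)
  rw [hP.eq_inter_of_mem_faces (hbij.mapsTo hm) hF hG hFG (minFace_subset_of_mem_faces hF hmF)
      (minFace_subset_of_mem_faces hG hmG),
    hP.eq_inter_of_mem_faces (hbij.mapsTo hm') hF hG hFG (minFace_subset_of_mem_faces hF hmF')
      (minFace_subset_of_mem_faces hG hmG')]

theorem IsConvexPolyhedron.exists_neighborSet_eq_pair (hP : IsConvexPolyhedron P)
    (hd : finrank ℝ (vectorSpan ℝ P) = 2) (hv : v ∈ vertices P) :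
    ∃ w w', w ≠ w' ∧ (graph P).neighborSet v = {w, w'} := by
  obtain ⟨e, e', hee', hedges⟩ := Set.ncard_eq_two.1 (hP.ncard_edges_at_vertex hd hv)
  obtain ⟨he, hve⟩ : e ∈ {e ∈ faces P 1 | v ∈ e} := hedges ▸ Or.inl rfl
  obtain ⟨he', hve'⟩ : e' ∈ {e ∈ faces P 1 | v ∈ e} := hedges ▸ Or.inr rfl
  obtain ⟨w, hw, rfl⟩ := hP.exists_adj_of_mem_edge he hv hve
  obtain ⟨w', hw', rfl⟩ := hP.exists_adj_of_mem_edge he' hv hve'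
  refine ⟨w, w', fun h => hee' (h ▸ rfl), Set.Subset.antisymm (fun u hu => ?_) ?_⟩
  · have hvu : (graph P).Adj v u := hu
    have hother (w) (hw : (graph P).Adj v w) (h : segment ℝ v u = segment ℝ v w) : u = w :=
      ((hP.eq_or_eq_of_mem_edge hw (hP.right_mem_vertices_of_adj hvu)
        (h ▸ right_mem_segment ℝ v u)).resolve_left hvu.ne).symm
    have hedge : segment ℝ v u ∈ {e ∈ faces P 1 | v ∈ e} := ⟨hvu, left_mem_segment ℝ v u⟩
    rw [hedges] at hedge
    exact hedge.imp (hother w hw) (hother w' hw')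
  · exact Set.pair_subset hw hw'

theorem IsConvexPolyhedron.exists_vertexFigure_eq_segment (hP : IsConvexPolyhedron P)
    (hd : finrank ℝ (vectorSpan ℝ P) = 2) (hv : v ∈ vertices P) :
    ∃ m ∈ edgeMidpoints P, ∃ m' ∈ edgeMidpoints P, m ≠ m' ∧ vertexFigure P v = segment ℝ m m' := by
  obtain ⟨w, w', hne, hN⟩ := hP.exists_neighborSet_eq_pair hd hv
  have hw : (graph P).Adj v w := hN.ge (Or.inl rfl)
  have hw' : (graph P).Adj v w' := hN.ge (Or.inr rfl)
  have hmid : midpoint ℝ v w ≠ midpoint ℝ v w' := fun h => hne (by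
    rwa [midpoint_eq_midpoint_iff_vsub_eq_vsub, vsub_self, eq_comm, vsub_eq_zero_iff_eq,
      eq_comm] at h)
  refine ⟨midpoint ℝ v w, ⟨v, w, hw, rfl⟩, midpoint ℝ v w', ⟨v, w', hw', rfl⟩, hmid, ?_⟩
  rw [← convexHull_pair, vertexFigure]
  congr 1
  ext m
  change (∃ u, u ∈ (graph P).neighborSet v ∧ m = midpoint ℝ v u) ↔ _
  simp only [hN, Set.mem_insert_iff, Set.mem_singleton_iff, exists_eq_or_imp, exists_eq_left]

/-- The incident pairs of a vertex and a facet of `P`; they index the edges of the rectification. -/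
def vertexFacetFlags (P : Set E3) : Set (E3 × Set E3) :=
  {q | q.1 ∈ vertices P ∧ q.2 ∈ faces P 2 ∧ q.1 ∈ q.2}

theorem IsConvexPolyhedron.ncard_vertexFacetFlags (hP : IsConvexPolyhedron P)
    (hd : finrank ℝ (vectorSpan ℝ P) = 3) : (vertexFacetFlags P).ncard = 2 * fNumber P 1 := by
  have hfin : (vertexFacetFlags P).Finite :=
    (hP.finite_vertices.prod (hP.finite_faces 2)).subset fun q hq => ⟨hq.1, hq.2.1⟩
  have hflags (e) (he : e ∈ faces P 1) :
      {q ∈ vertexFacetFlags P | q.1 ∈ e ∧ e ⊆ q.2}.ncard = 4 := by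
    have hprod : {q ∈ vertexFacetFlags P | q.1 ∈ e ∧ e ⊆ q.2} =
        {v ∈ vertices P | v ∈ e} ×ˢ {F ∈ faces P 2 | e ⊆ F} := by
      ext q
      exact ⟨fun ⟨⟨hv, hF, _⟩, hve, heF⟩ => ⟨⟨hv, hve⟩, hF, heF⟩,
        fun ⟨⟨hv, hve⟩, hF, heF⟩ => ⟨⟨hv, hF, heF hve⟩, hve, heF⟩⟩
    rw [hprod, Set.ncard_prod, hP.ncard_vertices_of_edge he, hP.ncard_facets_of_edge hd he]
  have hcount := ncard_mul_eq_ncard_mul hfin (hP.finite_faces 1) (fun q e => q.1 ∈ e ∧ e ⊆ q.2)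
    (fun q hq => hP.ncard_edges_of_flag hq.2.1 hq.1 hq.2.2) hflags
  rw [fNumber]
  lia

end Flags

namespace IsMidpointTruncation

variable {P F G K : Set E3} {g : E3 → E3} {b : E3 → ℝ} {v w x m m' : E3} {i : ℕ}

theorem of_mem_faces (h : IsMidpointTruncation P g b) (hF : F ∈ faces P i) :
    IsMidpointTruncation F g b where
  polyhedron := h.polyhedron.of_mem_faces hF
  inner_self v hv := h.inner_self v (h.polyhedron.vertices_of_mem_faces hF ▸ hv).1
  inner_adj v w hvw := h.inner_adj v w ((h.polyhedron.adj_iff_of_mem_faces hF).1 hvw).1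

theorem vertexFigure_eq (h : IsMidpointTruncation P g b) (hv : v ∈ vertices P) :
    vertexFigure P v = {x ∈ P | inner ℝ (g v) x = b v} := by
  refine Set.Subset.antisymm (fun x hx => ?_) ?_
  · refine ⟨h.polyhedron.rectify_subset (vertexFigure_subset_rectify hx), ?_⟩
    refine convexHull_min ?_ (convex_inner_eq (g v) (b v)) hx
    rintro _ ⟨w, hvw, rfl⟩
    exact h.inner_midpoint_adj hvw
  · rintro x ⟨hx, hxb⟩
    have hxv : x ≠ v := by
      rintro rfl
      linarith [h.inner_self x hv]
    obtain ⟨t, -, p, hp, rfl, hval⟩ := h.exists_cone hv hx hxv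
    obtain rfl : t = 1 / 2 := by linarith
    convert midpoint_mem_vertexFigure hp using 1
    rw [midpoint_eq_smul_add, invOf_eq_inv]
    module

theorem mem_vertexFigure_iff (h : IsMidpointTruncation P g b) (hv : v ∈ vertices P)
    (hm : m ∈ edgeMidpoints P) : m ∈ vertexFigure P v ↔ v ∈ minFace P m := by
  rw [h.vertexFigure_eq hv]
  refine ⟨fun hmv => ?_, fun hvm => ⟨?_, h.inner_edgeMidpoints_eq hv hm hvm⟩⟩
  · by_contra hvm
    exact (h.inner_edgeMidpoints_lt hv hm hvm).ne hmv.2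
  · exact h.polyhedron.rectify_subset (subset_convexHull ℝ _ hm)

theorem rectify_eq_of_constraints (h : IsMidpointTruncation P g b) {H : Set (E3 × ℝ)}
    (hPH : P = {x | ∀ q ∈ H, inner ℝ q.1 x ≤ q.2}) :
    rectify P = {x | ∀ q ∈ H ∪ (fun v => (g v, b v)) '' vertices P, inner ℝ q.1 x ≤ q.2} := by
  rw [h.rectify_eq]
  ext x
  have hx : x ∈ P ↔ ∀ q ∈ H, inner ℝ q.1 x ≤ q.2 := Set.ext_iff.1 hPH x
  simp only [Set.mem_ofPred_eq, hx, Set.mem_union, or_imp, forall_and, Set.forall_mem_image]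

theorem ne_zero_of_mem_union (h : IsMidpointTruncation P g b)
    (hd : 2 ≤ finrank ℝ (vectorSpan ℝ P)) {H : Set (E3 × ℝ)} (hH : ∀ q ∈ H, q.1 ≠ 0) :
    ∀ q ∈ H ∪ (fun v => (g v, b v)) '' vertices P, q.1 ≠ 0 := by
  rintro q (hq | ⟨v, hv, rfl⟩)
  exacts [hH q hq, h.ne_zero hd hv]

theorem isConvexPolyhedron_rectify (h : IsMidpointTruncation P g b)
    (hd : 2 ≤ finrank ℝ (vectorSpan ℝ P)) : IsConvexPolyhedron (rectify P) := by
  obtain ⟨-, H, hH, hH0, hPH⟩ := h.polyhedron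
  exact ⟨h.polyhedron.finite_edgeMidpoints.isCompact_convexHull ℝ, _,
    hH.union (h.polyhedron.finite_vertices.image _), h.ne_zero_of_mem_union hd hH0,
    h.rectify_eq_of_constraints hPH⟩

theorem isExposed_vertexFigure (h : IsMidpointTruncation P g b) (hv : v ∈ vertices P) :
    IsExposed ℝ (rectify P) (vertexFigure P v) := by
  have hsep : vertexFigure P v = {x ∈ rectify P | inner ℝ (g v) x = b v} := by
    refine Set.Subset.antisymm (fun x hx => ⟨vertexFigure_subset_rectify hx, ?_⟩) fun x hx => ?_
    · exact (h.vertexFigure_eq hv ▸ hx).2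
    · exact h.vertexFigure_eq hv ▸ ⟨h.polyhedron.rectify_subset hx.1, hx.2⟩
  rw [hsep]
  refine isExposed_of_inner_le fun x hx => ?_
  rw [h.rectify_eq] at hx
  exact hx.2 v hv

theorem eq_vertexFigure_or_eq_inter_of_mem_faces (h : IsMidpointTruncation P g b)
    (hd : finrank ℝ (vectorSpan ℝ P) = 3) (hK : K ∈ faces (rectify P) 2) :
    (∃ v ∈ vertices P, K = vertexFigure P v) ∨ ∃ F ∈ faces P 2, K = rectify P ∩ F := by
  have hsub := h.polyhedron.rectify_subset
  have hspan := h.polyhedron.vectorSpan_rectify (by simp [hd])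
  obtain ⟨-, H, hH, hH0, hPH⟩ := id h.polyhedron
  obtain ⟨q, hq, rfl⟩ := (h.isConvexPolyhedron_rectify (by simp [hd])).exists_constraint_of_facet
    (hH.union (h.polyhedron.finite_vertices.image _))
    (h.ne_zero_of_mem_union (by simp [hd]) hH0) (h.rectify_eq_of_constraints hPH)
    (by rw [hspan, hd]) hK
  rcases hq with hq | ⟨v, hv, rfl⟩
  · have hqP (x) (hx : x ∈ P) : inner ℝ q.1 x ≤ q.2 := by
      rw [hPH] at hx
      exact hx q hq
    have hinter := (h.polyhedron.rectify_inter_sep fun x => inner ℝ q.1 x = q.2).symm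
    have hKF : {x ∈ rectify P | inner ℝ q.1 x = q.2} ⊆ {x ∈ P | inner ℝ q.1 x = q.2} :=
      hinter ▸ Set.inter_subset_right
    refine Or.inr ⟨{x ∈ P | inner ℝ q.1 x = q.2},
      ⟨hK.1.mono hKF, isExposed_of_inner_le hqP, ?_⟩, hinter⟩
    have hlt := finrank_vectorSpan_lt_of_inner_eq (F := {x ∈ P | inner ℝ q.1 x = q.2})
      (hH0 q hq) fun x hx => hx.2
    rw [finrank_euclideanSpace_fin] at hlt
    exact (Nat.le_of_lt_succ hlt).antisymm
      (hK.2.2.ge.trans (Submodule.finrank_mono (vectorSpan_mono ℝ hKF)))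
  · refine Or.inl ⟨v, hv, ?_⟩
    rw [h.vertexFigure_eq hv]
    refine Set.Subset.antisymm (fun x hx => ⟨hsub hx.1, hx.2⟩) fun x hx => ⟨?_, hx.2⟩
    exact vertexFigure_subset_rectify (h.vertexFigure_eq hv ▸ hx)

theorem eq_midpoint_of_mem_segment (h : IsMidpointTruncation P g b) (hvw : (graph P).Adj v w)
    (hx : x ∈ segment ℝ v w) (hxR : x ∈ rectify P) : x = midpoint ℝ v w := by
  have hv := h.polyhedron.left_mem_vertices_of_adj hvw
  have hw := h.polyhedron.right_mem_vertices_of_adj hvw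
  rw [h.rectify_eq] at hxR
  obtain ⟨s, t, -, -, hst, rfl⟩ := hx
  have hle := hxR.2 v hv
  have hge := hxR.2 w hw
  rw [inner_add_right, inner_smul_right, inner_smul_right, h.inner_self v hv,
    h.inner_adj v w hvw] at hle
  rw [inner_add_right, inner_smul_right, inner_smul_right, h.inner_self w hw,
    h.inner_adj w v hvw.symm] at hge
  obtain rfl : s = 1 - t := by linarith
  obtain rfl : t = 1 / 2 := by linarith
  rw [midpoint_eq_smul_add, invOf_eq_inv]
  module

theorem vertices_rectify (h : IsMidpointTruncation P g b)
    (hd : 2 ≤ finrank ℝ (vectorSpan ℝ P)) : vertices (rectify P) = edgeMidpoints P := by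
  rw [(h.isConvexPolyhedron_rectify hd).vertices_eq_extremePoints]
  refine extremePoints_convexHull_subset.antisymm ?_
  rintro _ ⟨v, w, hvw, rfl⟩
  refine ⟨subset_convexHull ℝ _ ⟨v, w, hvw, rfl⟩, fun x hx y hy hm => ?_⟩
  refine h.eq_midpoint_of_mem_segment hvw ?_ hx
  rw [← h.polyhedron.minFace_midpoint hvw]
  exact left_mem_minFace_of_mem_openSegment (h.polyhedron.rectify_subset hx)
    (h.polyhedron.rectify_subset hy) hm

theorem fNumber_zero_rectify (h : IsMidpointTruncation P g b)
    (hd : 2 ≤ finrank ℝ (vectorSpan ℝ P)) : fNumber (rectify P) 0 = fNumber P 1 := by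
  rw [fNumber_zero, h.vertices_rectify hd]
  exact h.polyhedron.bijOn_edgeMidpoints.ncard_eq

theorem vertexFigure_of_mem_faces (h : IsMidpointTruncation P g b) (hF : F ∈ faces P i)
    (hv : v ∈ vertices P) (hvF : v ∈ F) : vertexFigure F v = vertexFigure P v ∩ F := by
  rw [h.vertexFigure_eq hv,
    (h.of_mem_faces hF).vertexFigure_eq (h.polyhedron.vertices_of_mem_faces hF ▸ ⟨hv, hvF⟩)]
  ext x
  exact ⟨fun hx => ⟨⟨subset_of_mem_faces hF hx.1, hx.2⟩, hx.1⟩, fun hx => ⟨hx.2, hx.1.2⟩⟩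

theorem isExposed_rectify_inter (h : IsMidpointTruncation P g b) (hF : F ∈ faces P i) :
    IsExposed ℝ (rectify P) (rectify P ∩ F) := by
  obtain ⟨f, a, ha, rfl⟩ := exists_inner_of_isExposed hF.1 hF.2.1
  rw [h.polyhedron.rectify_inter_sep]
  exact isExposed_of_inner_le fun y hy => ha y (h.polyhedron.rectify_subset hy)

theorem vertexFigure_mem_faces_rectify (h : IsMidpointTruncation P g b) (hF : F ∈ faces P 2)
    (hv : v ∈ vertices P) (hvF : v ∈ F) : vertexFigure F v ∈ faces (rectify P) 1 := by
  have hvF' : v ∈ vertices F := h.polyhedron.vertices_of_mem_faces hF ▸ ⟨hv, hvF⟩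
  obtain ⟨m, -, m', -, hne, heq⟩ :=
    (h.polyhedron.of_mem_faces hF).exists_vertexFigure_eq_segment hF.2.2 hvF'
  refine ⟨heq ▸ ⟨m, left_mem_segment ℝ m m'⟩, ?_, by rw [heq, finrank_vectorSpan_segment hne]⟩
  have hinter : vertexFigure F v = vertexFigure P v ∩ (rectify P ∩ F) := by
    rw [h.vertexFigure_of_mem_faces hF hv hvF, ← Set.inter_assoc,
      Set.inter_eq_left.2 vertexFigure_subset_rectify]
  rw [hinter]
  exact (h.isExposed_vertexFigure hv).inter (h.isExposed_rectify_inter hF)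

theorem eq_of_mem_vertexFigure (h : IsMidpointTruncation P g b) (hm : m ∈ edgeMidpoints P)
    (hm' : m' ∈ edgeMidpoints P) (hne : m ≠ m') (hv : v ∈ vertices P) (hw : w ∈ vertices P)
    (hmv : m ∈ vertexFigure P v) (hmv' : m' ∈ vertexFigure P v) (hmw : m ∈ vertexFigure P w)
    (hmw' : m' ∈ vertexFigure P w) : v = w :=
  h.polyhedron.eq_of_mem_vertices_of_mem_minFace hm hm' hne hv hw
    ((h.mem_vertexFigure_iff hv hm).1 hmv) ((h.mem_vertexFigure_iff hv hm').1 hmv')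
    ((h.mem_vertexFigure_iff hw hm).1 hmw) ((h.mem_vertexFigure_iff hw hm').1 hmw')

theorem injOn_vertexFigure (h : IsMidpointTruncation P g b) :
    Set.InjOn (fun q => vertexFigure q.2 q.1) (vertexFacetFlags P) := by
  rintro ⟨v, F⟩ ⟨hv, hF, hvF⟩ ⟨w, G⟩ ⟨hw, hG, hwG⟩ heq
  dsimp only at hF hvF hG hwG heq
  have hvF' : v ∈ vertices F := h.polyhedron.vertices_of_mem_faces hF ▸ ⟨hv, hvF⟩
  obtain ⟨m, hm, m', hm', hne, hseg⟩ :=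
    (h.polyhedron.of_mem_faces hF).exists_vertexFigure_eq_segment hF.2.2 hvF'
  replace hm := h.polyhedron.edgeMidpoints_subset_of_mem_faces hF hm
  replace hm' := h.polyhedron.edgeMidpoints_subset_of_mem_faces hF hm'
  have hmF : m ∈ vertexFigure F v := hseg ▸ left_mem_segment ℝ m m'
  have hmF' : m' ∈ vertexFigure F v := hseg ▸ right_mem_segment ℝ m m'
  have hmG : m ∈ vertexFigure G w := heq ▸ hmF
  have hmG' : m' ∈ vertexFigure G w := heq ▸ hmF'
  rw [h.vertexFigure_of_mem_faces hF hv hvF] at hmF hmF'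
  rw [h.vertexFigure_of_mem_faces hG hw hwG] at hmG hmG'
  exact Prod.ext (h.eq_of_mem_vertexFigure hm hm' hne hv hw hmF.1 hmF'.1 hmG.1 hmG'.1)
    (h.polyhedron.eq_of_mem_facets hm hm' hne hF hG hmF.2 hmF'.2 hmG.2 hmG'.2)

theorem exists_flag_subset (h : IsMidpointTruncation P g b)
    (hd : finrank ℝ (vectorSpan ℝ P) = 3) (hG : G ∈ faces (rectify P) 1) :
    ∃ v ∈ vertices P, ∃ F ∈ faces P 2, G ⊆ vertexFigure P v ∧ G ⊆ rectify P ∩ F := by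
  have hRp := h.isConvexPolyhedron_rectify (by simp [hd])
  have hdR : finrank ℝ (vectorSpan ℝ (rectify P)) = 3 := by
    rw [h.polyhedron.vectorSpan_rectify (by simp [hd]), hd]
  obtain ⟨m, hmV, hmG⟩ := hRp.exists_vertex_mem_face hG
  obtain ⟨m', hmV', hmG', hne⟩ := hRp.exists_vertex_mem_face_ne hG m
  rw [h.vertices_rectify (by simp [hd])] at hmV hmV'
  obtain ⟨K, L, hKL, hfacets⟩ := Set.ncard_eq_two.1 (hRp.ncard_facets_of_edge hdR hG)
  obtain ⟨hK, hGK⟩ : K ∈ {F ∈ faces (rectify P) 2 | G ⊆ F} := hfacets ▸ Or.inl rfl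
  obtain ⟨hL, hGL⟩ : L ∈ {F ∈ faces (rectify P) 2 | G ⊆ F} := hfacets ▸ Or.inr rfl
  rcases h.eq_vertexFigure_or_eq_inter_of_mem_faces hd hK with ⟨v, hv, rfl⟩ | ⟨F, hF, rfl⟩ <;>
  rcases h.eq_vertexFigure_or_eq_inter_of_mem_faces hd hL with ⟨w, hw, rfl⟩ | ⟨F', hF', rfl⟩
  · rw [h.eq_of_mem_vertexFigure hmV hmV' hne.symm hv hw (hGK hmG) (hGK hmG') (hGL hmG)
      (hGL hmG')] at hKL
    exact (hKL rfl).elim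
  · exact ⟨v, hv, F', hF', hGK, hGL⟩
  · exact ⟨w, hw, F, hF, hGL, hGK⟩
  · rw [h.polyhedron.eq_of_mem_facets hmV hmV' hne.symm hF hF' (hGK hmG).2 (hGK hmG').2
      (hGL hmG).2 (hGL hmG').2] at hKL
    exact (hKL rfl).elim

theorem bijOn_vertexFigure (h : IsMidpointTruncation P g b)
    (hd : finrank ℝ (vectorSpan ℝ P) = 3) :
    Set.BijOn (fun q => vertexFigure q.2 q.1) (vertexFacetFlags P) (faces (rectify P) 1) := by
  have hRp := h.isConvexPolyhedron_rectify (by simp [hd])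
  refine ⟨fun q ⟨hv, hF, hvF⟩ => h.vertexFigure_mem_faces_rectify hF hv hvF,
    h.injOn_vertexFigure, fun G hG => ?_⟩
  obtain ⟨v, hv, F, hF, hGv, hGF⟩ := h.exists_flag_subset hd hG
  obtain ⟨m, hm, hmG⟩ := hRp.exists_vertex_mem_face hG
  rw [h.vertices_rectify (by simp [hd])] at hm
  have hvF : v ∈ F :=
    minFace_subset_of_mem_faces hF (hGF hmG).2 ((h.mem_vertexFigure_iff hv hm).1 (hGv hmG))
  refine ⟨(v, F), ⟨hv, hF, hvF⟩, ?_⟩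
  refine (hRp.eq_of_subset_of_mem_faces hG (h.vertexFigure_mem_faces_rectify hF hv hvF) ?_).symm
  rw [h.vertexFigure_of_mem_faces hF hv hvF]
  exact Set.subset_inter hGv fun x hx => (hGF hx).2

theorem fNumber_one_rectify (h : IsMidpointTruncation P g b)
    (hd : finrank ℝ (vectorSpan ℝ P) = 3) : fNumber (rectify P) 1 = 2 * fNumber P 1 := by
  rw [← h.polyhedron.ncard_vertexFacetFlags hd]
  exact (h.bijOn_vertexFigure hd).ncard_eq.symm

theorem fNumber_two_rectify (h : IsMidpointTruncation P g b)
    (hd : finrank ℝ (vectorSpan ℝ P) = 3) : fNumber (rectify P) 2 = 2 + fNumber P 1 := by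
  have heuler := (h.isConvexPolyhedron_rectify (by simp [hd])).euler_formula
    (by rw [h.polyhedron.vectorSpan_rectify (by simp [hd]), hd])
  rw [h.fNumber_zero_rectify (by simp [hd]), h.fNumber_one_rectify hd] at heuler
  lia

end IsMidpointTruncation

section Semiregular

theorem map_centroid_of_image_eq {E : Type*} [AddCommGroup E] [Module ℝ E] (φ : E ≃ᵃ[ℝ] E)
    {s : Finset E} (hs : s.Nonempty) (hφ : φ '' s = s) :
    φ (s.centroid ℝ id) = s.centroid ℝ id := by
  have hmap : s.map φ.toEquiv.toEmbedding = s := Finset.coe_injective (by simpa using hφ)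
  calc φ (s.centroid ℝ id) = s.centroid ℝ (φ ∘ id) :=
        s.map_affineCombination id _ (s.sum_centroidWeights_eq_one_of_nonempty ℝ hs) φ.toAffineMap
    _ = (s.map φ.toEquiv.toEmbedding).centroid ℝ id :=
        (Finset.centroid_map ℝ s φ.toEquiv.toEmbedding id).symm
    _ = s.centroid ℝ id := by rw [hmap]

variable {P : Set E3} {v w u : E3}

theorem IsConvexPolyhedron.image_vertices (hP : IsConvexPolyhedron P) (φ : E3 ≃ᵃⁱ[ℝ] E3)
    (hφ : φ '' P = P) : φ '' vertices P = vertices P := by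
  have hsegment (x y : E3) : φ '' openSegment ℝ x y = openSegment ℝ (φ x) (φ y) :=
    image_openSegment ℝ φ.toAffineEquiv.toAffineMap x y
  have hextreme (v : E3) : φ v ∈ P.extremePoints ℝ ↔ v ∈ P.extremePoints ℝ := by
    nth_rw 1 [← hφ]
    simp only [mem_extremePoints, Set.forall_mem_image, φ.injective.mem_set_image, ← hsegment,
      φ.injective.eq_iff]
  rw [hP.vertices_eq_extremePoints]
  ext v
  obtain ⟨v, rfl⟩ := φ.surjective v
  rw [φ.injective.mem_set_image, hextreme]

theorem IsSemiregular.exists_dist_vertices_eq (h : IsSemiregular P) :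
    ∃ (c : E3) (r : ℝ), ∀ v ∈ vertices P, dist v c = r := by
  rcases (vertices P).eq_empty_or_nonempty with hempty | ⟨v₀, hv₀⟩
  · exact ⟨0, 0, by simp [hempty]⟩
  have hfin := h.polyhedron.finite_vertices
  refine ⟨hfin.toFinset.centroid ℝ id, dist v₀ (hfin.toFinset.centroid ℝ id), fun v hv => ?_⟩
  obtain ⟨φ, hφ, rfl⟩ := h.vertex_transitive v₀ hv₀ v hv
  have hfix := map_centroid_of_image_eq φ.toAffineEquiv (s := hfin.toFinset)
    ⟨v₀, hfin.mem_toFinset.2 hv₀⟩ (by simpa using h.polyhedron.image_vertices φ hφ)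
  conv_lhs => rw [← hfix]
  exact φ.dist_map _ _

theorem IsSemiregular.dist_eq_of_adj (h : IsSemiregular P) (hw : (graph P).Adj v w)
    (hu : (graph P).Adj v u) : dist v w = dist v u := by
  have hP := h.polyhedron
  have hv := hP.left_mem_vertices_of_adj hw
  refine hP.forall_edges_at_vertex (Q := fun e => ∀ u, e = segment ℝ v u → dist v w = dist v u)
    hv ?_ hw (left_mem_segment ℝ v w) ?_ (segment ℝ v u) hu (left_mem_segment ℝ v u) u rfl
  · rintro F hF e he _ he' hve - heF heF' hQ u rfl
    obtain ⟨w', hw', rfl⟩ := hP.exists_adj_of_mem_edge he hv hve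
    rw [hQ w' rfl]
    exact (h.regular_faces F hF).equilateral v w' v u
      ((hP.adj_iff_of_mem_faces hF).2 ⟨hw', heF⟩) ((hP.adj_iff_of_mem_faces hF).2 ⟨he', heF'⟩)
  · intro u hwu
    have hvu : segment ℝ v u ∈ faces P 1 := hwu ▸ hw
    rcases hP.eq_or_eq_of_mem_edge hvu (hP.right_mem_vertices_of_adj hw)
      (hwu ▸ right_mem_segment ℝ v w) with heq | rfl
    exacts [(hw.ne heq).elim, rfl]

-- The midpoints of equally long edges at `v` lie on a circle around the axis through `c` and `v`.
theorem IsConvexPolyhedron.hasFlatVertexFigures_of_dist_eq (hP : IsConvexPolyhedron P)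
    {c : E3} {r : ℝ} (hc : ∀ v ∈ vertices P, dist v c = r)
    (hadj : ∀ v w u, (graph P).Adj v w → (graph P).Adj v u → dist v w = dist v u) :
    HasFlatVertexFigures P := by
  intro v hv
  by_cases hisolated : ∀ w, ¬(graph P).Adj v w
  · simp [vertexFigure, hisolated, coplanar_empty]
  push Not at hisolated
  obtain ⟨w, hw⟩ := hisolated
  have hne : v - c ≠ 0 := by
    intro heq
    have hwv : dist w c = dist v c := by rw [hc w (hP.right_mem_vertices_of_adj hw), hc v hv]
    rw [sub_eq_zero.1 heq, dist_self, dist_eq_zero] at hwv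
    exact hw.ne (sub_eq_zero.1 heq ▸ hwv.symm)
  have hconst (u : E3) (hu : (graph P).Adj v u) :
      inner ℝ (v - c) u = inner ℝ (v - c) w := by
    have hwu : dist w c = dist u c := by
      rw [hc w (hP.right_mem_vertices_of_adj hw), hc u (hP.right_mem_vertices_of_adj hu)]
    have hwu' : dist w v = dist u v := by rw [dist_comm, hadj v w u hw hu, dist_comm]
    rw [← sub_eq_zero, ← inner_sub_right]
    exact EuclideanGeometry.inner_vsub_vsub_of_dist_eq_of_dist_eq hwu hwu'
  have hfigure (x : E3) (hx : x ∈ vertexFigure P v) :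
      inner ℝ (v - c) x = inner ℝ (v - c) (midpoint ℝ v w) := by
    refine convexHull_min ?_ (convex_inner_eq (v - c) _) hx
    rintro _ ⟨u, hu, rfl⟩
    rw [Set.mem_ofPred_eq, inner_midpoint, inner_midpoint, hconst u hu]
  have hlt := finrank_vectorSpan_lt_of_inner_eq hne hfigure
  rw [finrank_euclideanSpace_fin] at hlt
  exact coplanar_iff_finrank_le_two.2 (Nat.le_of_lt_succ hlt)

theorem IsSemiregular.hasFlatVertexFigures (h : IsSemiregular P) : HasFlatVertexFigures P := by
  obtain ⟨c, r, hc⟩ := h.exists_dist_vertices_eq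
  exact h.polyhedron.hasFlatVertexFigures_of_dist_eq hc fun _ _ _ => h.dist_eq_of_adj

end Semiregular

section Sequence

variable {P : Set E3} {k : ℕ}

theorem R_succ (k : ℕ) (P : Set E3) : R (k + 1) P = rectify (R k P) :=
  Function.iterate_succ_apply' rectify k P

theorem exists_isMidpointTruncation_R (hP : IsConvexPolyhedron P)
    (hd : finrank ℝ (vectorSpan ℝ P) = 3) (hflat : ∀ i ≤ k, HasFlatVertexFigures (R i P)) :
    finrank ℝ (vectorSpan ℝ (R k P)) = 3 ∧ ∃ g b, IsMidpointTruncation (R k P) g b := by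
  induction k with
  | zero => exact ⟨hd, (hflat 0 le_rfl).exists_isMidpointTruncation hP hd⟩
  | succ k ih =>
    obtain ⟨hdk, g, b, h⟩ := ih fun i hi => hflat i (hi.trans k.le_succ)
    have hd' : finrank ℝ (vectorSpan ℝ (R (k + 1) P)) = 3 := by
      rw [R_succ, h.polyhedron.vectorSpan_rectify (by simp [hdk]), hdk]
    refine ⟨hd', (hflat _ le_rfl).exists_isMidpointTruncation ?_ hd'⟩
    rw [R_succ]
    exact h.isConvexPolyhedron_rectify (by simp [hdk])

theorem fNumber_one_R (hP : IsConvexPolyhedron P) (hd : finrank ℝ (vectorSpan ℝ P) = 3)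
    (hflat : ∀ i < k, HasFlatVertexFigures (R i P)) :
    fNumber (R k P) 1 = 2 ^ k * fNumber P 1 := by
  induction k with
  | zero => simp [R]
  | succ k ih =>
    obtain ⟨hdk, g, b, h⟩ := exists_isMidpointTruncation_R hP hd fun i hi =>
      hflat i (Nat.lt_succ_of_le hi)
    rw [R_succ, h.fNumber_one_rectify hdk, ih fun i hi => hflat i (Nat.lt_succ_of_lt hi), pow_succ]
    ring

theorem vol_R (hP : IsConvexPolyhedron P) (hd : finrank ℝ (vectorSpan ℝ P) = 3)
    (hflat : ∀ i < k, HasFlatVertexFigures (R i P)) :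
    vol (R k P) = vol P - ∑ N ∈ Finset.range k,
      ∑ᶠ v ∈ vertices (R N P), vol (vertexCone (R N P) v) := by
  induction k with
  | zero => simp [R]
  | succ k ih =>
    obtain ⟨hdk, g, b, h⟩ := exists_isMidpointTruncation_R hP hd fun i hi =>
      hflat i (Nat.lt_succ_of_le hi)
    rw [R_succ, h.vol_rectify (by simp [hdk]), ih fun i hi => hflat i (Nat.lt_succ_of_lt hi),
      Finset.sum_range_succ, sub_sub]

end Sequence

end Rectification

end

theorem theorem4_general (P : Set Rectification.E3) (k : ℕ) (hk : 1 ≤ k)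
    (hP : Rectification.IsConvexPolyhedron P)
    (hd : Module.finrank ℝ (vectorSpan ℝ P) = 3)
    (hflat : ∀ i < k, Rectification.HasFlatVertexFigures (Rectification.R i P)) :
    ((Rectification.fNumber (Rectification.R k P) 0,
      Rectification.fNumber (Rectification.R k P) 1,
      Rectification.fNumber (Rectification.R k P) 2) : ℕ × ℕ × ℕ) =
      (2 ^ (k - 1) * Rectification.fNumber P 1,
       2 ^ k * Rectification.fNumber P 1,
       2 + 2 ^ (k - 1) * Rectification.fNumber P 1) ∧
    Rectification.vol (Rectification.R k P) =
      Rectification.vol P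
        - ∑ᶠ v ∈ Rectification.vertices P, Rectification.vol (Rectification.vertexCone P v)
        - ∑ N ∈ Finset.Ico 1 k, ∑ᶠ v ∈ Rectification.vertices (Rectification.R N P),
            Rectification.vol (Rectification.vertexCone (Rectification.R N P) v) := by
  open Rectification in
  obtain ⟨n, rfl⟩ : ∃ n, k = n + 1 := ⟨k - 1, by omega⟩
  constructor
  · obtain ⟨hdn, g, b, h⟩ := exists_isMidpointTruncation_R hP hd fun i hi =>
      hflat i (Nat.lt_succ_of_le hi)
    have hn := fNumber_one_R hP hd fun i hi => hflat i (Nat.lt_succ_of_lt hi)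
    rw [fNumber_one_R hP hd hflat, R_succ, h.fNumber_zero_rectify (by simp [hdn]),
      h.fNumber_two_rectify hdn, hn, Nat.add_sub_cancel]
  · rw [vol_R hP hd hflat, Finset.range_eq_Ico, Finset.sum_eq_sum_Ico_succ_bot n.succ_pos, sub_sub]
    rfl

theorem theorem4 (P : Set Rectification.E3) (k : ℕ) (hk : 1 ≤ k)
    (hP : ∀ i < k, Rectification.IsSemiregular (Rectification.R i P)) :
    ((Rectification.fNumber (Rectification.R k P) 0,
      Rectification.fNumber (Rectification.R k P) 1,
      Rectification.fNumber (Rectification.R k P) 2) : ℕ × ℕ × ℕ) =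
      (2 ^ (k - 1) * Rectification.fNumber P 1,
       2 ^ k * Rectification.fNumber P 1,
       2 + 2 ^ (k - 1) * Rectification.fNumber P 1) ∧
    Rectification.vol (Rectification.R k P) =
      Rectification.vol P
        - ∑ᶠ v ∈ Rectification.vertices P, Rectification.vol (Rectification.vertexCone P v)
        - ∑ N ∈ Finset.Ico 1 k, ∑ᶠ v ∈ Rectification.vertices (Rectification.R N P),
            Rectification.vol (Rectification.vertexCone (Rectification.R N P) v) := by
  exact theorem4_general P k hk (hP 0 hk).polyhedron (hP 0 hk).dim_eq fun i hi =>
    (hP i hi).hasFlatVertexFigures
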